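/- Let $X\subset\mathbb R^N$ be a (non-empty) real algebraic subset of dimension $d$, with ideal $I(X)\subset\mathbb R[x_1,\dots,x_N]$. Let $\mathcal L(X)$ be the set of germs of real analytic arcs $\gamma:(\mathbb R,0)\to\mathbb R^N$ with $f(\gamma(t))=0$ for all $f\in I(X)$. For $n\in\mathbb N$ let $\mathcal L_n(X)$ be the set of $n$-jets on $X$, that is, of the $\gamma\in(\mathbb R\{t\}/t^{n+1})^N\simeq\mathbb R^{(n+1)N}$ with $f(\gamma(t))\equiv 0 \bmod t^{n+1}$ for all $f\in I(X)$. Let $\pi_n:\mathcal L(X)\to\mathcal L_n(X)$ and $\pi^m_n:\mathcal L_m(X)\to\mathcal L_n(X)$ ($m\ge n$) be the truncation maps. The dimension of a semialgebraic set $A\subset\mathbb R^k$ is the Krull dimension of $\mathbb R[y_1,\dots,y_k]/I(A)$. Then, for all $n\in\mathbb N$: 1. $\dim \pi_n(\mathcal L(X))=(n+1)d$. 2. $\dim \mathcal L_n(X)\ge (n+1)d$. 3. For all $m\ge n$, the fibres of the restriction $\pi_m(\mathcal L(X))\to\pi_n(\mathcal L(X))$ of $\pi^m_n$ have dimension at most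 $(m-n)d$. 4. For every $\gamma\in\mathcal L_n(X)$, the fibre of $\pi^{n+1}_n:\mathcal L_{n+1}(X)\to\mathcal L_n(X)$ over $\gamma$ is either empty or isomorphic, by affine-linear maps, to the Zariski tangent space $T^{\mathrm{Zar}}_{\gamma(0)}X=\{v\in\mathbb R^N : \sum_i \frac{\partial f}{\partial x_i}(\gamma(0))\,v_i=0 \text{ for all } f\in I(X)\}$. 5. If moreover $X$ is non-singular (its local ring at every point is regular), then $\mathcal L_n(X)=\pi_n(\mathcal L(X))$ and $\dim\mathcal L_n(X)=(n+1)d$. -/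

import Mathlib

open Filter Topology

namespace RealAlg

/-- A real algebraic subset of `ℝ^σ`: the zero set of a family of real polynomials. -/
def IsAlgebraicSet {σ : Type*} (X : Set (σ → ℝ)) : Prop :=
  ∃ S : Set (MvPolynomial σ ℝ), X = {x | ∀ f ∈ S, MvPolynomial.eval x f = 0}

/-- The ring of polynomial functions `ℝ[x] / I(A)` on a subset `A` of `ℝ^σ`, where `I(A)` is the
ideal of all polynomials vanishing on `A`. -/
abbrev CoordRing {σ : Type*} (A : Set (σ → ℝ)) : Type _ :=
  MvPolynomial σ ℝ ⧸ MvPolynomial.vanishingIdeal ℝ A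

/-- The dimension of a semialgebraic (in particular, of an algebraic) subset `A` of `ℝ^σ`, as
usually defined in real algebraic geometry: the Krull dimension of `ℝ[x] / I(A)`.
The empty set has dimension `⊥`. -/
noncomputable def dim {σ : Type*} (A : Set (σ → ℝ)) : WithBot ℕ∞ :=
  ringKrullDim (CoordRing A)

/-- Evaluation of polynomial functions on `X` at a point `x` of `X`. -/
noncomputable def evalAt {σ : Type*} (X : Set (σ → ℝ)) (x : X) : CoordRing X →+* ℝ :=
  Ideal.Quotient.lift (MvPolynomial.vanishingIdeal ℝ X) (MvPolynomial.eval x.1)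
    (fun f hf => by simpa [MvPolynomial.aeval_eq_eval] using hf x.1 x.2)

/-- The maximal ideal of the coordinate ring of `X` at a point `x` of `X`. -/
noncomputable def idealAt {σ : Type*} (X : Set (σ → ℝ)) (x : X) : Ideal (CoordRing X) :=
  RingHom.ker (evalAt X x)

instance idealAt_isPrime {σ : Type*} (X : Set (σ → ℝ)) (x : X) : (idealAt X x).IsPrime :=
  RingHom.ker_isPrime (evalAt X x)

/-- `X` is non-singular: the local ring of `X` at each of its points is regular. -/
def IsNonsingular {σ : Type*} (X : Set (σ → ℝ)) : Prop :=
  ∀ x : X, IsRegularLocalRing (Localization.AtPrime (idealAt X x))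

/-- The Zariski tangent space of `X` at `x`: the common kernel of the linear parts at `x` of the
polynomials of `I(X)`. -/
noncomputable def tangentSpace {N : ℕ} (X : Set (Fin N → ℝ)) (x : Fin N → ℝ) :
    Submodule ℝ (Fin N → ℝ) where
  carrier := {v | ∀ f ∈ MvPolynomial.vanishingIdeal ℝ X,
    ∑ i, MvPolynomial.eval x (MvPolynomial.pderiv i f) * v i = 0}
  zero_mem' := fun f _ => by simp
  add_mem' := fun {v w} hv hw f hf => by
    simp only [Pi.add_apply, mul_add, Finset.sum_add_distrib, hv f hf, hw f hf, add_zero]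
  smul_mem' := fun c v hv f hf => by
    simp only [Pi.smul_apply, smul_eq_mul, mul_left_comm _ c, ← Finset.mul_sum, hv f hf, mul_zero]

/-- The space of `n`-jets on `ℝ^N`, identified with `ℝ^((n+1)N)`: the jet `γ` is the class modulo
`t^(n+1)` of the arc whose `i`-th component is `∑ k, γ (i, k) t^k`. -/
abbrev Jet (N n : ℕ) : Type := Fin N × Fin (n + 1) → ℝ

/-- The `i`-th component of the polynomial representative, of degree at most `n`, of an `n`-jet. -/
noncomputable def Jet.poly {N n : ℕ} (γ : Jet N n) (i : Fin N) : Polynomial ℝ :=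
  ∑ k : Fin (n + 1), Polynomial.monomial (k : ℕ) (γ (i, k))

/-- The origin `γ(0)` of a jet. -/
def Jet.origin {N n : ℕ} (γ : Jet N n) : Fin N → ℝ := fun i => γ (i, 0)

/-- The truncation map from `m`-jets to `n`-jets, for `n ≤ m`. -/
def trunc {N n m : ℕ} (h : n ≤ m) (γ : Jet N m) : Jet N n :=
  fun p => γ (p.1, Fin.castLE (Nat.add_le_add_right h 1) p.2)

/-- The set of `n`-jets on `X`: the jets `γ` with `f(γ(t)) ≡ 0 mod t^(n+1)` for all `f ∈ I(X)`. -/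
def jets {N : ℕ} (X : Set (Fin N → ℝ)) (n : ℕ) : Set (Jet N n) :=
  {γ | ∀ f ∈ MvPolynomial.vanishingIdeal ℝ X,
    (Polynomial.X : Polynomial ℝ) ^ (n + 1) ∣ MvPolynomial.aeval γ.poly f}

/-- `γ` represents a germ at `0` of an analytic arc on `X`: it is analytic at `0`, and
`f(γ(t)) = 0` as a germ for all `f ∈ I(X)`. Only the germ of `γ` at `0` matters. -/
def IsArcOn {N : ℕ} (X : Set (Fin N → ℝ)) (γ : ℝ → Fin N → ℝ) : Prop :=
  AnalyticAt ℝ γ 0 ∧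
    ∀ f ∈ MvPolynomial.vanishingIdeal ℝ X, ∀ᶠ t in 𝓝 (0 : ℝ), MvPolynomial.eval (γ t) f = 0

/-- The `n`-jet of an arc: its Taylor coefficients at `0` up to order `n`. -/
noncomputable def arcJet {N : ℕ} (n : ℕ) (γ : ℝ → Fin N → ℝ) : Jet N n :=
  fun p => iteratedDeriv (p.2 : ℕ) (fun t => γ t p.1) 0 / (Nat.factorial (p.2 : ℕ) : ℝ)

/-- The set of `n`-jets of analytic arcs on `X`. -/
def liftableJets {N : ℕ} (X : Set (Fin N → ℝ)) (n : ℕ) : Set (Jet N n) :=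
  {ξ | ∃ γ, IsArcOn X γ ∧ arcJet n γ = ξ}

/-- The subsets `A` and `B` of two real vector spaces are identified with each other by mutually
inverse affine-linear maps (so, in particular, by mutually inverse polynomial maps). -/
def AffinelyIsomorphic {E F : Type*} [AddCommGroup E] [Module ℝ E] [AddCommGroup F] [Module ℝ F]
    (A : Set E) (B : Set F) : Prop :=
  ∃ (φ : E →ᵃ[ℝ] F) (ψ : F →ᵃ[ℝ] E),
    Set.MapsTo φ A B ∧ Set.MapsTo ψ B A ∧ Set.LeftInvOn ψ φ A ∧ Set.LeftInvOn φ ψ B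

end RealAlg

/-! The upper bounds in 1 and 3 count transcendence degrees. An arc is chosen for each jet of a set
`A`; its coefficients are functions on `A`, and modulo a suitable prime of the ring of all functions
they form a single arc `y` on `X` over a field `F`. Since `y` satisfies the equations in `I(X)`, at
most `d` of its components are algebraically independent over `ℝ`. Components whose coefficients of
order `j` are independent over the earlier coefficients are themselves independent
(`algebraicIndependent_of_coeff`). Hence each order adds at most `d` to the transcendence degree,
and orders with fixed coefficients add nothing (`dim_le_of_formal_arcs`).

For the lower bounds, some point of `X` has both local ring and tangent space of dimension `d`
(`exists_regular_point`). At such a point `X` contains an analytic copy of the tangent space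
(`AdaptedChart.exists_parametrization`): if an equation of `X` were nonzero along the curve over a
tangent line, then `d - 1` functions would cut out the point on `X`, against Krull's height theorem.
The tangent coordinates of an arc can therefore be prescribed freely near the point, which gives `(n
+ 1) d` independent functions of the jet.

Assertion 4 is the first-order Taylor formula. For 5, regularity puts every point of `X` in the
situation above, with the local dimension in place of `d`. A jet is lifted by keeping its tangent
coordinates and setting its normal coordinates, already zero modulo `t^(n+1)`, equal to zero. -/

namespace RealAlg

/-! ### Dimension and height in finitely generated algebras. -/

section CommAlg

/-- Incomparability keeps chains strict under contraction; lying over and going up lift them. -/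
theorem ringKrullDim_eq_of_isIntegral (R S : Type*) [CommRing R] [CommRing S] [Algebra R S]
    [Algebra.IsIntegral R S] [FaithfulSMul R S] : ringKrullDim S = ringKrullDim R := by
  apply le_antisymm
  · refine Order.krullDim_le_of_strictMono (PrimeSpectrum.comap (algebraMap R S)) ?_
    intro p q hpq
    exact Ideal.IsIntegral.comap_lt_comap (R := R) hpq
  · refine iSup_le fun l => ?_
    obtain ⟨P, hP, hPp, hPl⟩ := Ideal.exists_ideal_over_prime_of_isIntegral (S := S)
      l.head.asIdeal ⊥ (by
        rw [← RingHom.ker_eq_comap_bot, (RingHom.injective_iff_ker_eq_bot _).mp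
          (FaithfulSMul.algebraMap_injective R S)]
        exact bot_le)
    have : P.LiesOver l.head.asIdeal := ⟨hPl.symm⟩
    obtain ⟨L, hL, -, -⟩ := Ideal.exists_ltSeries_of_hasGoingUp l P
    rw [← hL]
    exact le_iSup (fun l : LTSeries (PrimeSpectrum S) => (l.length : WithBot ℕ∞)) L

/-- The nonzero elements of the domain form a multiplicative set whose image misses `0`, so some
prime, and a minimal prime below it, avoids that image. No finiteness of `B` is needed: it is later
a ring of arbitrary functions. -/
theorem exists_isPrime_injective_comp {A B : Type*} [CommRing A] [IsDomain A] [CommRing B]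
    (g : A →+* B) (hg : Function.Injective g) :
    ∃ P ∈ minimalPrimes B, Function.Injective ((Ideal.Quotient.mk P).comp g) := by
  obtain ⟨Q, hQ, -, hd⟩ := Ideal.exists_le_prime_disjoint (⊥ : Ideal B)
    ((nonZeroDivisors A).map g) (by
      rw [Set.disjoint_left]
      rintro _ h0 ⟨a, ha, rfl⟩
      have : g a = 0 := h0
      rw [map_eq_zero_iff g hg] at this
      exact nonZeroDivisors.ne_zero ha this)
  obtain ⟨P, hP, hPQ⟩ := Ideal.exists_minimalPrimes_le (bot_le : (⊥ : Ideal B) ≤ Q)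
  refine ⟨P, hP, (injective_iff_map_eq_zero _).mpr fun a ha => ?_⟩
  by_contra h0
  refine Set.disjoint_left.mp hd (hPQ (Ideal.Quotient.eq_zero_iff_mem.mp ha))
    ⟨a, mem_nonZeroDivisors_of_ne_zero h0, rfl⟩

theorem isTranscendenceBasis_of_isIntegral {k B : Type*} [Field k] [CommRing B] [IsDomain B]
    [Algebra k B] {s : ℕ} (g : MvPolynomial (Fin s) k →ₐ[k] B) (hg : Function.Injective g)
    (hint : g.toRingHom.IsIntegral) :
    IsTranscendenceBasis k (fun i => g (MvPolynomial.X i)) := by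
  have h1 : AlgebraicIndependent k (fun i => g (MvPolynomial.X i)) := by
    have : MvPolynomial.aeval (fun i => g (MvPolynomial.X i)) = g := by
      ext; simp
    rw [algebraicIndependent_iff_injective_aeval, this]
    exact hg
  rw [h1.isTranscendenceBasis_iff_isAlgebraic]
  refine ⟨fun b => ?_⟩
  obtain ⟨p, hp, hpb⟩ := hint b
  have hmem : ∀ q : MvPolynomial (Fin s) k,
      g q ∈ Algebra.adjoin k (Set.range fun i => g (MvPolynomial.X i)) := by
    intro q
    rw [Algebra.adjoin_range_eq_range_aeval]
    refine ⟨q, ?_⟩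
    have : MvPolynomial.aeval (fun i => g (MvPolynomial.X i)) = g := by
      ext; simp
    rw [this]; rfl
  let g' : MvPolynomial (Fin s) k →+*
      Algebra.adjoin k (Set.range fun i => g (MvPolynomial.X i)) :=
    g.toRingHom.codRestrict _ hmem
  refine IsIntegral.isAlgebraic ⟨p.map g', hp.map _, ?_⟩
  rw [Polynomial.eval₂_map]
  exact hpb

/-- Independence survives modulo a suitable minimal prime, and for the resulting affine domain
Noether normalization identifies dimension with transcendence degree. -/
theorem natCard_le_ringKrullDim_of_algebraicIndependent {k B ι : Type*} [Field k] [CommRing B]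
    [Algebra k B] [Algebra.FiniteType k B] [Fintype ι] {x : ι → B}
    (hx : AlgebraicIndependent k x) : (Fintype.card ι : WithBot ℕ∞) ≤ ringKrullDim B := by
  obtain ⟨P, hP, hinj⟩ := exists_isPrime_injective_comp
    (MvPolynomial.aeval x : MvPolynomial ι k →ₐ[k] B).toRingHom
    (algebraicIndependent_iff_injective_aeval.mp hx)
  have := hP.1.1
  obtain ⟨s, g, hg, hgi⟩ := exists_integral_inj_algHom_of_fg k (B ⧸ P)
  have hdim : ringKrullDim (B ⧸ P) = s := by
    let _ := g.toRingHom.toAlgebra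
    have : Algebra.IsIntegral (MvPolynomial (Fin s) k) (B ⧸ P) := ⟨hgi⟩
    have : FaithfulSMul (MvPolynomial (Fin s) k) (B ⧸ P) :=
      (faithfulSMul_iff_algebraMap_injective _ _).mpr hg
    rw [ringKrullDim_eq_of_isIntegral (MvPolynomial (Fin s) k) (B ⧸ P)]
    simp
  refine le_trans ?_ (ringKrullDim_quotient_le P)
  rw [hdim]
  have hb := isTranscendenceBasis_of_isIntegral g hg hgi
  have h2 : AlgebraicIndependent k (fun i => Ideal.Quotient.mk P (x i)) := by
    rw [algebraicIndependent_iff_injective_aeval]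
    convert hinj
    rename_i p
    have : (MvPolynomial.aeval fun i => (Ideal.Quotient.mk P) (x i)) =
      (Ideal.Quotient.mkₐ k P).comp (MvPolynomial.aeval x : MvPolynomial ι k →ₐ[k] B) := by
      ext; simp
    rw [this]; rfl
  have h3 := h2.lift_cardinalMk_le_trdeg
  have h4 := hb.lift_cardinalMk_eq_trdeg
  simp at h3 h4
  rw [← h4] at h3
  exact_mod_cast h3

/-- Removing one variable, a maximal ideal contracts to a maximal ideal by the Jacobson property,
and its height drops by exactly one. -/
theorem height_eq_of_isMaximal_mvPolynomial {k : Type*} [Field k] (s : ℕ)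
    (m : Ideal (MvPolynomial (Fin s) k)) [hm : m.IsMaximal] : m.height = s := by
  induction s with
  | zero =>
    have h := Ideal.height_le_ringKrullDim_of_ne_top hm.ne_top
    simp at h
    simpa using h
  | succ s ih =>
    let e := (MvPolynomial.finSuccEquiv k s).toRingEquiv
    rw [← e.height_map m]
    have : (m.map e).IsMaximal := Ideal.map_isMaximal_of_equiv e
    have h2 : ((m.map e).comap Polynomial.C).IsMaximal :=
      Polynomial.isMaximal_comap_C_of_isJacobsonRing _
    have : (m.map e).LiesOver ((m.map e).comap Polynomial.C) := ⟨rfl⟩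
    rw [Polynomial.height_eq_height_add_one ((m.map e).comap Polynomial.C) (m.map e), ih]
    simp

/-- Every maximal ideal of an affine domain has height the number of variables of a Noether
normalization. -/
theorem height_eq_of_isMaximal_of_isIntegral {k B : Type*} [Field k] [CommRing B] [IsDomain B]
    [Algebra k B] [Algebra.FiniteType k B] {s : ℕ} (g : MvPolynomial (Fin s) k →ₐ[k] B)
    (hg : Function.Injective g) (hint : g.toRingHom.IsIntegral) (m : Ideal B) [hm : m.IsMaximal] :
    (s : ℕ∞) ≤ m.height := by
  let _ := g.toRingHom.toAlgebra
  have : Algebra.IsIntegral (MvPolynomial (Fin s) k) B := ⟨hint⟩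
  have : FaithfulSMul (MvPolynomial (Fin s) k) B :=
    (faithfulSMul_iff_algebraMap_injective _ _).mpr hg
  have : IsNoetherianRing B := Algebra.FiniteType.isNoetherianRing k B
  have : (m.comap (algebraMap (MvPolynomial (Fin s) k) B)).IsMaximal :=
    Ideal.isMaximal_comap_of_isIntegral_of_isMaximal m
  have : m.LiesOver (m.comap (algebraMap (MvPolynomial (Fin s) k) B)) := ⟨rfl⟩
  -- Going down is available because the polynomial ring is integrally closed.
  rw [Ideal.height_eq_height_add_of_liesOver_of_hasGoingDown
    (m.comap (algebraMap (MvPolynomial (Fin s) k) B)) m, height_eq_of_isMaximal_mvPolynomial]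
  exact le_self_add

/-- Krull's height theorem for ideals of definition, with the defining condition read off modulo a
higher power of `M`. -/
theorem height_le_of_pow_le_sup {R : Type*} [CommRing R] [IsNoetherianRing R] {M : Ideal R}
    [hM : M.IsPrime] (s : Finset R) (hs : Ideal.span (s : Set R) ≤ M) (e : ℕ)
    (h : M ^ e ≤ Ideal.span (s : Set R) ⊔ M ^ (e + 1)) : M.height ≤ s.card := by
  apply Ideal.height_le_card_of_mem_minimalPrimes_span_finset
  refine ⟨⟨hM, hs⟩, fun q ⟨hq, hsq⟩ hqM => ?_⟩
  rcases Nat.eq_zero_or_pos e with rfl | he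
  · exfalso
    simp only [pow_zero, Ideal.one_eq_top, zero_add, pow_one, top_le_iff] at h
    rw [sup_eq_right.mpr hs] at h
    exact hM.ne_top h
  -- Modulo `q`, the image of `M ^ e` absorbs every power of the image of `M`, so it is idempotent
  -- and generated by an idempotent of a domain. The idempotent `0` gives `M ≤ q`; the idempotent
  -- `1` contradicts `M ≠ ⊤`.
  let f := Ideal.Quotient.mk q
  have hs0 : (Ideal.span (s : Set R)).map f = ⊥ := by
    rw [Ideal.map_eq_bot_iff_le_ker, Ideal.mk_ker]; exact hsq
  have h1 : (M.map f) ^ e ≤ (M.map f) ^ e * (M.map f) := by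
    have := Ideal.map_mono (f := f) h
    rwa [Ideal.map_sup, hs0, bot_sup_eq, Ideal.map_pow, Ideal.map_pow, pow_succ] at this
  have h2 : (M.map f) ^ e = (M.map f) ^ e * (M.map f) := le_antisymm h1 Ideal.mul_le_left
  have h3 : ∀ n, (M.map f) ^ e = (M.map f) ^ e * (M.map f) ^ n := by
    intro n
    induction n with
    | zero => simp
    | succ n ih => rw [pow_succ, ← mul_assoc, ← ih, ← h2]
  obtain ⟨ε, hε, hε'⟩ := (Ideal.isIdempotentElem_iff_of_fg ((M.map f) ^ e)
    (IsNoetherian.noetherian _)).mp (h3 e).symm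
  rcases IsIdempotentElem.iff_eq_zero_or_one.mp hε with h0 | h0
  · rw [h0] at hε'
    have : M.map f = ⊥ := by
      have h4 : (M.map f) ^ e = ⊥ := by rw [hε']; simp
      exact eq_bot_iff.mpr fun x hx => by
        have : x ^ e ∈ (M.map f) ^ e := Ideal.pow_mem_pow hx e
        rw [h4] at this
        exact eq_zero_of_pow_eq_zero this
    rwa [Ideal.map_eq_bot_iff_le_ker, Ideal.mk_ker] at this
  · exfalso
    have h5 : (1 : R ⧸ q) ∈ M.map f := by
      apply Ideal.pow_le_self he.ne'
      rw [hε', h0]; exact Submodule.mem_span_singleton_self _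
    rw [Ideal.mem_map_iff_of_surjective f Ideal.Quotient.mk_surjective] at h5
    obtain ⟨x, hx, hx1⟩ := h5
    have : x - 1 ∈ q := Ideal.Quotient.eq.mp (by simpa using hx1)
    apply hM.ne_top
    rw [Ideal.eq_top_iff_one]
    have := M.sub_mem hx (hqM this)
    simpa using this

end CommAlg

/-! ### Upper bounds: transcendence degree of the coefficients of an arc. -/

section UpperBound

open scoped Cardinal

theorem finiteMultiplicity_C_X {E ι : Type*} [CommRing E] [IsDomain E]
    {Q : MvPolynomial ι (Polynomial E)} (hQ : Q ≠ 0) :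
    FiniteMultiplicity (MvPolynomial.C Polynomial.X) Q := by
  obtain ⟨e, he⟩ := MvPolynomial.ne_zero_iff.mp hQ
  refine ⟨(Q.coeff e).natDegree, fun h => he ?_⟩
  rw [← map_pow, MvPolynomial.C_dvd_iff_dvd_coeff] at h
  exact Polynomial.eq_zero_of_dvd_of_natDegree_lt (h e) (by simp)

/-- Once `t ^ j` is inverted, the substitution is undone by `X i ↦ t^(-j) (X i - a i)`. -/
theorem injective_affine_substitution {k E ι : Type*} [Field k] [CommRing E] [IsDomain E]
    [Algebra k E] (j : ℕ) (a : ι → Polynomial E) :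
    Function.Injective (MvPolynomial.aeval (R := k) fun i =>
      (MvPolynomial.C (a i) + MvPolynomial.C (Polynomial.X ^ j) * MvPolynomial.X i :
        MvPolynomial ι (Polynomial E))) := by
  let L := FractionRing (Polynomial E)
  let t : L := algebraMap (Polynomial E) L Polynomial.X
  have ht : t ≠ 0 := by
    rw [Ne, map_eq_zero_iff _ (IsFractionRing.injective (Polynomial E) L)]
    exact Polynomial.X_ne_zero
  let ψ : MvPolynomial ι (Polynomial E) →+* MvPolynomial ι L :=
    MvPolynomial.eval₂Hom (MvPolynomial.C.comp (algebraMap (Polynomial E) L)) fun i =>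
      MvPolynomial.C ((t ^ j)⁻¹) * (MvPolynomial.X i - MvPolynomial.C (algebraMap _ L (a i)))
  have hψ : ∀ p : MvPolynomial ι k, ψ (MvPolynomial.aeval (R := k) (fun i =>
      (MvPolynomial.C (a i) + MvPolynomial.C (Polynomial.X ^ j) * MvPolynomial.X i :
        MvPolynomial ι (Polynomial E))) p) = MvPolynomial.map (algebraMap k L) p := by
    intro p
    induction p using MvPolynomial.induction_on with
    | C c =>
      simp only [MvPolynomial.aeval_C, MvPolynomial.map_C]
      rw [IsScalarTower.algebraMap_apply k (Polynomial E) (MvPolynomial ι (Polynomial E)),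
        MvPolynomial.algebraMap_eq, IsScalarTower.algebraMap_apply k (Polynomial E) L]
      simp [ψ]
    | add p q hp hq => simp only [map_add, hp, hq]
    | mul_X p i hp =>
      simp only [map_mul, hp, MvPolynomial.aeval_X, MvPolynomial.map_X, map_add]
      congr 1
      simp only [ψ, MvPolynomial.eval₂Hom_C, MvPolynomial.eval₂Hom_X', RingHom.comp_apply]
      rw [← mul_assoc, ← MvPolynomial.C_mul, map_pow, mul_inv_cancel₀ (pow_ne_zero j ht)]
      simp
  intro p q hpq
  have := congrArg ψ hpq
  rw [hψ, hψ] at this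
  exact MvPolynomial.map_injective _ (algebraMap k L).injective this

/-- If the coefficients of order `< j` of a family of power series lie in `E`, and those of
order `j` are algebraically independent over `E`, then the family is algebraically
independent over the base field. -/
theorem algebraicIndependent_of_coeff {k E F ι : Type*} [Field k] [CommRing E] [IsDomain E]
    [Field F] [Algebra k E] [Algebra E F] [Algebra k F] [IsScalarTower k E F]
    [FaithfulSMul E F] (y : ι → PowerSeries F) (j : ℕ)
    (hE : ∀ i, ∀ l < j, PowerSeries.coeff l (y i) ∈ Set.range (algebraMap E F))
    (h : AlgebraicIndependent E fun i => PowerSeries.coeff j (y i)) :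
    AlgebraicIndependent k y := by
  have ha : ∀ i, ∃ a : Polynomial E,
      a.map (algebraMap E F) = PowerSeries.trunc j (y i) := by
    intro i
    have : PowerSeries.trunc j (y i) ∈ Polynomial.lifts (algebraMap E F) := by
      rw [Polynomial.lifts_iff_coeff_lifts]
      intro n
      rw [PowerSeries.coeff_trunc]
      split_ifs with hn
      · exact hE i n hn
      · exact ⟨0, map_zero _⟩
    exact (Polynomial.mem_lifts _).mp this
  choose a ha using ha
  -- Write `y i = a i + t^j * w i`, where `w i` has the coefficient of order `j` as constant term. A
  -- relation `P` among the `y i` becomes a nonzero `Q` over `E[t]` vanishing at `w`; dividing `Q`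
  -- by its highest power of `t` and setting `t = 0` leaves a nonzero relation over `E` among the
  -- coefficients of order `j`.
  let w : ι → PowerSeries F := fun i => PowerSeries.mk fun n => PowerSeries.coeff (n + j) (y i)
  let em : Polynomial E →+* PowerSeries F :=
    (Polynomial.coeToPowerSeries.ringHom).comp (Polynomial.mapRingHom (algebraMap E F))
  have hyw : ∀ i, y i = em (a i) + em (Polynomial.X ^ j) * w i := by
    intro i
    conv_lhs => rw [PowerSeries.eq_X_pow_mul_shift_add_trunc j (y i)]
    rw [add_comm]
    simp [em, w, ha]
  let ev : MvPolynomial ι (Polynomial E) →+* PowerSeries F := MvPolynomial.eval₂Hom em w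
  rw [algebraicIndependent_iff]
  intro P hP
  by_contra hP0
  set Q := MvPolynomial.aeval (R := k) (fun i =>
      (MvPolynomial.C (a i) + MvPolynomial.C (Polynomial.X ^ j) * MvPolynomial.X i :
        MvPolynomial ι (Polynomial E))) P with hQdef
  have hQ0 : Q ≠ 0 := by
    intro h0
    exact hP0 (injective_affine_substitution j a (by rw [← hQdef, h0, map_zero]))
  have hevQ : ev Q = 0 := by
    rw [← hP, hQdef]
    clear hP hP0 hQ0 hQdef Q
    induction P using MvPolynomial.induction_on with
    | C c =>
      simp only [MvPolynomial.aeval_C]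
      rw [IsScalarTower.algebraMap_apply k (Polynomial E) (MvPolynomial ι (Polynomial E)),
        MvPolynomial.algebraMap_eq, PowerSeries.algebraMap_apply,
        IsScalarTower.algebraMap_apply k E F]
      simp [ev, em]
    | add p q hp hq => simp only [map_add, hp, hq]
    | mul_X p i hp =>
      simp only [map_mul, hp, MvPolynomial.aeval_X, map_add]
      congr 1
      rw [hyw]
      simp [ev]
  obtain ⟨Q', hQ', hnd⟩ := (finiteMultiplicity_C_X hQ0).exists_eq_pow_mul_and_not_dvd
  have hevQ' : ev Q' = 0 := by
    rw [hQ', map_mul, map_pow] at hevQ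
    refine (mul_eq_zero.mp hevQ).resolve_left (pow_ne_zero _ ?_)
    simp [ev, em]
  rw [MvPolynomial.C_dvd_iff_dvd_coeff] at hnd
  push Not at hnd
  obtain ⟨e, he⟩ := hnd
  rw [Polynomial.X_dvd_iff] at he
  have h0 : MvPolynomial.map Polynomial.constantCoeff Q' = 0 := by
    apply (algebraicIndependent_iff.mp h)
    have hcc : ∀ q : MvPolynomial ι (Polynomial E),
        MvPolynomial.aeval (fun i => PowerSeries.coeff j (y i))
          (MvPolynomial.map Polynomial.constantCoeff q) = PowerSeries.constantCoeff (ev q) := by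
      intro q
      induction q using MvPolynomial.induction_on with
      | C c =>
        simp [ev, em, ← PowerSeries.coeff_zero_eq_constantCoeff_apply]
      | add p q hp hq => simp only [map_add, hp, hq]
      | mul_X p i hp =>
        simp only [map_mul, hp, MvPolynomial.aeval_X, MvPolynomial.map_X]
        congr 1
        simp [ev, w]
    rw [hcc, hevQ', map_zero]
  apply he
  have := congrArg (MvPolynomial.coeff e) h0
  simpa [MvPolynomial.coeff_map] using this

/-- A transcendence basis can be chosen among the generators. -/
theorem trdeg_adjoin_range_le {E F κ : Type} [CommRing E] [IsDomain E] [Field F] [Algebra E F]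
    [FaithfulSMul E F] [Finite κ] {d : ℕ} (x : κ → F)
    (hx : ∀ (ι : Type) [Fintype ι] (σ : ι → κ),
      AlgebraicIndependent E (fun i => x (σ i)) → Fintype.card ι ≤ d) :
    Algebra.trdeg E (Algebra.adjoin E (Set.range x)) ≤ d := by
  let s' : Set (Algebra.adjoin E (Set.range x)) := (↑) ⁻¹' (Set.range x)
  have htop : Algebra.adjoin E s' = ⊤ := Algebra.adjoin_adjoin_coe_preimage
  have halg : Algebra.IsAlgebraic (Algebra.adjoin E s') (Algebra.adjoin E (Set.range x)) := by
    refine ⟨fun a => ?_⟩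
    have ha : a ∈ Algebra.adjoin E s' := by rw [htop]; trivial
    exact isAlgebraic_algebraMap (⟨a, ha⟩ : Algebra.adjoin E s')
  obtain ⟨t, hts, ht⟩ := exists_isTranscendenceBasis_subset (R := E) s'
  rw [← ht.cardinalMk_eq_trdeg]
  have hσ : ∀ a : t, ∃ i, x i = ((a : Algebra.adjoin E (Set.range x)) : F) := fun a => hts a.2
  choose σ hσ using hσ
  have hfin : Finite t := Finite.of_injective σ fun a b hab => by
    apply Subtype.ext; apply Subtype.ext
    rw [← hσ, ← hσ, hab]
  have := Fintype.ofFinite t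
  have h2 : AlgebraicIndependent E fun a => x (σ a) := by
    have := ht.1.map' (f := (Algebra.adjoin E (Set.range x)).val) Subtype.val_injective
    convert this using 1
    funext a
    exact hσ a
  have := hx t σ h2
  rw [Cardinal.mk_fintype]
  exact_mod_cast this

/-- The inductive step: adjoining all coefficients of order `j` costs at most `d`, by
`algebraicIndependent_of_coeff` and additivity of the transcendence degree. -/
theorem exists_trdeg_adjoin_coeff_le {k F : Type} [Field k] [Field F] [Algebra k F] {N d : ℕ}
    (y : Fin N → PowerSeries F)
    (hy : ∀ (ι : Type) [Fintype ι] (σ : ι → Fin N),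
      AlgebraicIndependent k (fun i => y (σ i)) → Fintype.card ι ≤ d)
    (E : Subalgebra k F) (j : ℕ) (hE : ∀ i, ∀ l < j, PowerSeries.coeff l (y i) ∈ E) :
    ∃ E' : Subalgebra k F, E ≤ E' ∧ (∀ i, PowerSeries.coeff j (y i) ∈ E') ∧
      Algebra.trdeg k E' ≤ Algebra.trdeg k E + d := by
  have h1 := trdeg_adjoin_range_le (E := E) (d := d) (fun i => PowerSeries.coeff j (y i))
    fun ι _ σ h => hy ι σ (algebraicIndependent_of_coeff (E := E) _ j
      (fun i l hl => ⟨⟨_, hE (σ i) l hl⟩, rfl⟩) h)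
  let A := Algebra.adjoin E (Set.range fun i => PowerSeries.coeff j (y i))
  have hA : FaithfulSMul E A := (faithfulSMul_iff_algebraMap_injective _ _).mpr fun a b h =>
    Subtype.ext (congrArg (fun z : A => (z : F)) h)
  have h2 : Algebra.trdeg k A = Algebra.trdeg k E + Algebra.trdeg E A :=
    (trdeg_add_eq k E).symm
  have h3 : Algebra.trdeg k (A.restrictScalars k) = Algebra.trdeg k A := by
    rfl
  refine ⟨A.restrictScalars k, fun x hx => ?_, fun i => ?_, ?_⟩
  · exact A.algebraMap_mem ⟨x, hx⟩
  · exact Algebra.subset_adjoin (R := E) ⟨i, rfl⟩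
  · rw [h3, h2]
    gcongr

theorem exists_trdeg_subalgebra_coeff_le {k F : Type} [Field k] [Field F] [Algebra k F]
    {N d : ℕ} (y : Fin N → PowerSeries F)
    (hy : ∀ (ι : Type) [Fintype ι] (σ : ι → Fin N),
      AlgebraicIndependent k (fun i => y (σ i)) → Fintype.card ι ≤ d)
    (q : ℕ) (hq : ∀ i, ∀ l < q, PowerSeries.coeff l (y i) ∈ Set.range (algebraMap k F)) (n : ℕ) :
    ∃ E : Subalgebra k F, (∀ i, ∀ l < q + n, PowerSeries.coeff l (y i) ∈ E) ∧
      Algebra.trdeg k E ≤ ((n * d : ℕ) : Cardinal) := by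
  induction n with
  | zero =>
    refine ⟨⊥, fun i l hl => ?_, ?_⟩
    · exact hq i l hl
    · have : Algebra.IsAlgebraic k (⊥ : Subalgebra k F) := by
        refine ⟨fun ⟨x, hx⟩ => ?_⟩
        obtain ⟨r, rfl⟩ := hx
        exact isAlgebraic_algebraMap (A := (⊥ : Subalgebra k F)) r
      rw [trdeg_eq_zero]
      simp
  | succ n ih =>
    obtain ⟨E, hE, hEd⟩ := ih
    obtain ⟨E', hEE', hE', hd⟩ := exists_trdeg_adjoin_coeff_le y hy E (q + n) hE
    refine ⟨E', fun i l hl => ?_, ?_⟩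
    · rcases Nat.lt_succ_iff_lt_or_eq.mp hl with h | h
      · exact hEE' (hE i l h)
      · subst h; exact hE' i
    · calc _ ≤ _ := hd
        _ ≤ ((n * d : ℕ) : Cardinal) + d := by gcongr
        _ = _ := by push_cast; ring

/-- A polynomial function on `A`, as a function. -/
noncomputable def coordRingToFun {σ : Type*} (A : Set (σ → ℝ)) : CoordRing A →ₐ[ℝ] (A → ℝ) :=
  Ideal.Quotient.liftₐ (MvPolynomial.vanishingIdeal ℝ A)
    (MvPolynomial.aeval fun p (a : A) => a.1 p) (by
      intro f hf
      funext a
      have h : (MvPolynomial.aeval (R := ℝ) (fun p (a : A) => a.1 p) f) a =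
          MvPolynomial.aeval a.1 f := by
        have : (Pi.evalAlgHom ℝ (fun _ : A => ℝ) a).comp
            (MvPolynomial.aeval (R := ℝ) fun p (a : A) => a.1 p) =
              MvPolynomial.aeval a.1 := by
          ext; simp
        exact congrArg (fun φ => φ f) this
      exact h.trans (hf a.1 a.2))

theorem coordRingToFun_mk {σ : Type*} (A : Set (σ → ℝ)) (f : MvPolynomial σ ℝ) (a : A) :
    coordRingToFun A (Ideal.Quotient.mk _ f) a = MvPolynomial.eval a.1 f := by
  have : ((Pi.evalAlgHom ℝ (fun _ : A => ℝ) a).comp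
      ((coordRingToFun A).comp (Ideal.Quotient.mkₐ ℝ _))) = MvPolynomial.aeval a.1 := by
    ext i
    have h : coordRingToFun A (Ideal.Quotient.mk _ (MvPolynomial.X i)) =
        MvPolynomial.aeval (fun p (a : A) => a.1 p) (MvPolynomial.X i) :=
      Ideal.Quotient.lift_mk _ _ _
    simp [h]
  have := congrArg (fun φ => φ f) this
  simpa [MvPolynomial.aeval_eq_eval] using this

theorem coordRingToFun_injective {σ : Type*} (A : Set (σ → ℝ)) :
    Function.Injective (coordRingToFun A) := by
  rw [injective_iff_map_eq_zero]
  intro b hb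
  obtain ⟨f, rfl⟩ := Ideal.Quotient.mk_surjective b
  rw [Ideal.Quotient.eq_zero_iff_mem]
  intro x hx
  have := congrFun hb ⟨x, hx⟩
  rw [coordRingToFun_mk] at this
  simpa [MvPolynomial.aeval_eq_eval] using this

theorem powerSeries_map_aeval {k B C σ : Type*} [Field k] [CommRing B] [CommRing C] [Algebra k B]
    [Algebra k C] (φ : B →ₐ[k] C) (Y : σ → PowerSeries B) (f : MvPolynomial σ k) :
    PowerSeries.map φ.toRingHom (MvPolynomial.aeval Y f) =
      MvPolynomial.aeval (fun i => PowerSeries.map φ.toRingHom (Y i)) f := by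
  rw [MvPolynomial.aeval_def, MvPolynomial.aeval_def, MvPolynomial.hom_eval₂]
  congr 1
  ext r : 1
  simp [PowerSeries.algebraMap_apply]

/-- Sets of jets of formal arcs on a `d`-dimensional set, the first `q` coefficients being fixed,
have dimension at most `d` times the number of the remaining coefficients. -/
theorem dim_le_of_formal_arcs {N d m : ℕ} {X : Set (Fin N → ℝ)}
    (hd : dim X = (d : WithBot ℕ∞)) (A : Set (Jet N m)) (q n : ℕ) (hqn : q + n = m + 1)
    (hA : ∀ ξ ∈ A, ∃ c : Fin N → PowerSeries ℝ,
      (∀ f ∈ MvPolynomial.vanishingIdeal ℝ X, MvPolynomial.aeval c f = 0) ∧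
      (∀ i (k : Fin (m + 1)), PowerSeries.coeff (k : ℕ) (c i) = ξ (i, k)))
    (hq : ∀ i (k : Fin (m + 1)), (k : ℕ) < q → ∃ r, ∀ ξ ∈ A, ξ (i, k) = r) :
    dim A ≤ ((n * d : ℕ) : WithBot ℕ∞) := by
  unfold dim
  rcases subsingleton_or_nontrivial (CoordRing A) with hs | hs
  · rw [ringKrullDim_eq_bot_of_subsingleton]; exact bot_le
  obtain ⟨s, g, hg, hgi⟩ := exists_integral_inj_algHom_of_fg ℝ (CoordRing A)
  have hdim : ringKrullDim (CoordRing A) = s := by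
    let _ := g.toRingHom.toAlgebra
    have : Algebra.IsIntegral (MvPolynomial (Fin s) ℝ) (CoordRing A) := ⟨hgi⟩
    have : FaithfulSMul (MvPolynomial (Fin s) ℝ) (CoordRing A) :=
      (faithfulSMul_iff_algebraMap_injective _ _).mpr hg
    rw [ringKrullDim_eq_of_isIntegral (MvPolynomial (Fin s) ℝ) (CoordRing A)]
    simp
  rw [hdim]
  -- The arc chosen for a jet may depend on it in any way, so its higher coefficients are only
  -- functions on `A`. The prime is therefore taken in the ring of all functions, so that the `s`
  -- variables of the Noether normalization stay independent in `F`.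
  obtain ⟨P, hP, hinj⟩ := exists_isPrime_injective_comp
    ((coordRingToFun A).comp g).toRingHom ((coordRingToFun_injective A).comp hg)
  have := hP.1.1
  let F := FractionRing ((A → ℝ) ⧸ P)
  let θ : (A → ℝ) →ₐ[ℝ] F :=
    (IsScalarTower.toAlgHom ℝ ((A → ℝ) ⧸ P) F).comp (Ideal.Quotient.mkₐ ℝ P)
  choose! c hc0 hcξ using hA
  let Y : Fin N → PowerSeries (A → ℝ) := fun i =>
    PowerSeries.mk fun n a => PowerSeries.coeff n (c a.1 i)
  let y : Fin N → PowerSeries F := fun i => PowerSeries.map θ.toRingHom (Y i)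
  have hY0 : ∀ f ∈ MvPolynomial.vanishingIdeal ℝ X, MvPolynomial.aeval Y f = 0 := by
    intro f hf
    ext n a
    have h1 := powerSeries_map_aeval (Pi.evalAlgHom ℝ (fun _ : A => ℝ) a) Y f
    have h2 : (fun i => PowerSeries.map (Pi.evalAlgHom ℝ (fun _ : A => ℝ) a).toRingHom (Y i)) =
        c a.1 := by
      funext i
      ext n
      simp [Y]
    rw [h2, hc0 a.1 a.2 f hf] at h1
    have h3 := congrArg (PowerSeries.coeff n) h1
    rw [PowerSeries.coeff_map, map_zero] at h3
    exact h3
  have hy0 : ∀ f ∈ MvPolynomial.vanishingIdeal ℝ X, MvPolynomial.aeval y f = 0 := by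
    intro f hf
    rw [← powerSeries_map_aeval θ Y f, hY0 f hf, map_zero]
  let κ : CoordRing X →ₐ[ℝ] PowerSeries F :=
    Ideal.Quotient.liftₐ _ (MvPolynomial.aeval y) hy0
  -- Independent components of `y` come, through `κ`, from independent coordinate functions on `X`.
  have hy : ∀ (ι : Type) [Fintype ι] (σ : ι → Fin N),
      AlgebraicIndependent ℝ (fun i => y (σ i)) → Fintype.card ι ≤ d := by
    intro ι _ σ h
    have h1 : AlgebraicIndependent ℝ fun i : ι =>
        (Ideal.Quotient.mk _ (MvPolynomial.X (σ i)) : CoordRing X) := by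
      apply AlgebraicIndependent.of_comp κ
      convert h using 1
      funext i
      exact (Ideal.Quotient.lift_mk _ _ _).trans (by simp)
    have := natCard_le_ringKrullDim_of_algebraicIndependent h1
    rw [show ringKrullDim (CoordRing X) = d from hd] at this
    exact_mod_cast this
  obtain ⟨E, hE, hEd⟩ := exists_trdeg_subalgebra_coeff_le y hy q (fun i l hl => by
    have hlm : l < m + 1 := by omega
    obtain ⟨r, hr⟩ := hq i ⟨l, hlm⟩ hl
    refine ⟨r, ?_⟩
    have : (fun a : A => PowerSeries.coeff l (c a.1 i)) = algebraMap ℝ (A → ℝ) r := by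
      funext a
      rw [hcξ a.1 a.2 i ⟨l, hlm⟩, hr a.1 a.2]; rfl
    simp only [y, Y, PowerSeries.coeff_map, PowerSeries.coeff_mk, this]
    exact (θ.commutes r).symm) n
  -- The coordinates of the jet are the coefficients of `y` of order less than `m + 1 = q + n`, so
  -- `E` receives all of `CoordRing A`, and `s` is at most its transcendence degree.
  have hmem : ∀ b : CoordRing A, θ (coordRingToFun A b) ∈ E := by
    intro b
    obtain ⟨f, rfl⟩ := Ideal.Quotient.mk_surjective b
    induction f using MvPolynomial.induction_on with
    | C r =>
      have h1 : (Ideal.Quotient.mk _ (MvPolynomial.C r) : CoordRing A) = algebraMap ℝ _ r := rfl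
      rw [h1, AlgHom.commutes, AlgHom.commutes]
      exact E.algebraMap_mem r
    | add f f' h h' => rw [map_add, map_add, map_add]; exact E.add_mem h h'
    | mul_X f p h =>
      rw [map_mul, map_mul, map_mul]
      refine E.mul_mem h ?_
      have := hE p.1 p.2 (by omega)
      convert this using 1
      simp only [y, Y, PowerSeries.coeff_map, PowerSeries.coeff_mk]
      change θ _ = θ _
      congr 1
      funext a
      rw [coordRingToFun_mk, hcξ a.1 a.2]
      simp
  let G : MvPolynomial (Fin s) ℝ →ₐ[ℝ] E :=
    ((θ.comp (coordRingToFun A)).comp g).codRestrict E fun b => hmem (g b)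
  have hG : Function.Injective G := by
    intro a b hab
    have h1 := congrArg (fun z : E => (z : F)) hab
    exact hinj (IsFractionRing.injective ((A → ℝ) ⧸ P) F h1)
  have hz : AlgebraicIndependent ℝ fun i => G (MvPolynomial.X i) := by
    rw [algebraicIndependent_iff_injective_aeval]
    have : MvPolynomial.aeval (fun i => G (MvPolynomial.X i)) = G := by
      ext; simp
    rw [this]; exact hG
  have h1 := hz.lift_cardinalMk_le_trdeg
  simp only [Cardinal.lift_id, Cardinal.mk_fin] at h1
  have h2 := h1.trans hEd
  have h3 : s ≤ n * d := by exact_mod_cast h2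
  exact_mod_cast h3

end UpperBound

/-! ### First-order Taylor expansion and the fibres of jet spaces. -/

section Taylor

theorem aeval_sub_aeval_mem {k B σ : Type*} [CommRing k] [CommRing B] [Algebra k B] (I : Ideal B)
    (a b : σ → B) (h : ∀ i, a i - b i ∈ I) (f : MvPolynomial σ k) :
    MvPolynomial.aeval a f - MvPolynomial.aeval b f ∈ I := by
  rw [← Ideal.Quotient.eq, ← Ideal.Quotient.mkₐ_eq_mk k, MvPolynomial.comp_aeval_apply,
    MvPolynomial.comp_aeval_apply]
  congr 2
  funext i
  exact Ideal.Quotient.eq.mpr (h i)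

/-- First-order Taylor formula with remainder. It serves for perturbations divisible by a power of
`t` and for expansions at a point. -/
theorem aeval_add_sub_mem_sq {k B σ : Type*} [CommRing k] [CommRing B] [Algebra k B] [Fintype σ]
    (I : Ideal B) (a δ : σ → B) (hδ : ∀ i, δ i ∈ I) (f : MvPolynomial σ k) :
    MvPolynomial.aeval (fun i => a i + δ i) f - MvPolynomial.aeval a f -
      ∑ i, δ i * MvPolynomial.aeval a (MvPolynomial.pderiv i f) ∈ I ^ 2 := by
  classical
  induction f using MvPolynomial.induction_on with
  | C r => simp
  | add p q hp hq =>
    have := add_mem hp hq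
    convert this using 1
    simp only [map_add, mul_add, Finset.sum_add_distrib]
    ring
  | mul_X p j hp =>
    have h1 : MvPolynomial.aeval (fun i => a i + δ i) p - MvPolynomial.aeval a p ∈ I :=
      aeval_sub_aeval_mem I _ _ (fun i => by simpa using hδ i) p
    have h2 : (MvPolynomial.aeval (fun i => a i + δ i) p - MvPolynomial.aeval a p) * δ j ∈ I ^ 2 := by
      rw [pow_two]; exact Ideal.mul_mem_mul h1 (hδ j)
    have h3 : ∑ i, δ i * MvPolynomial.aeval a (MvPolynomial.pderiv i (p * MvPolynomial.X j)) =
        (∑ i, δ i * MvPolynomial.aeval a (MvPolynomial.pderiv i p)) * a j +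
          MvPolynomial.aeval a p * δ j := by
      simp only [MvPolynomial.pderiv_mul, MvPolynomial.pderiv_X, map_add, map_mul,
        MvPolynomial.aeval_X, mul_add, Finset.sum_add_distrib, Finset.sum_mul]
      congr 1
      · exact Finset.sum_congr rfl fun i _ => by ring
      · rw [Finset.sum_eq_single j]
        · simp; ring
        · intro i _ hij
          simp [hij.symm]
        · simp
    rw [h3]
    have h4 := add_mem (Ideal.mul_mem_right (a j) _ hp) h2
    convert h4 using 1
    simp only [map_mul, MvPolynomial.aeval_X]
    ring

theorem eval_zero_aeval_poly {N n : ℕ} (γ : Jet N n) (f : MvPolynomial (Fin N) ℝ) :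
    (MvPolynomial.aeval γ.poly f).eval 0 = MvPolynomial.eval γ.origin f := by
  have h : ((Polynomial.aeval (0 : ℝ)).comp (MvPolynomial.aeval γ.poly) :
      MvPolynomial (Fin N) ℝ →ₐ[ℝ] ℝ) = MvPolynomial.aeval γ.origin := by
    ext i
    simp only [AlgHom.comp_apply, MvPolynomial.aeval_X, Jet.poly, map_sum, Jet.origin]
    rw [Finset.sum_eq_single 0]
    · simp
    · intro k _ hk
      simp [Polynomial.aeval_monomial, Fin.val_ne_zero_iff.mpr hk]
    · simp
  have := congrArg (fun φ => φ f) h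
  simpa [MvPolynomial.aeval_eq_eval] using this

theorem coeff_poly {N n : ℕ} (γ : Jet N n) (i : Fin N) (l : ℕ) :
    (γ.poly i).coeff l = if h : l < n + 1 then γ (i, ⟨l, h⟩) else 0 := by
  simp only [Jet.poly, Polynomial.finsetSum_coeff, Polynomial.coeff_monomial]
  split_ifs with h
  · rw [Finset.sum_eq_single ⟨l, h⟩]
    · simp
    · intro k _ hk
      rw [if_neg]
      rintro rfl
      exact hk rfl
    · simp
  · apply Finset.sum_eq_zero
    intro k _
    rw [if_neg]
    rintro rfl
    exact h k.2

theorem poly_eq_add_of_trunc_eq {N n : ℕ} (ξ η : Jet N (n + 1))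
    (h : trunc (Nat.le_succ n) ξ = trunc (Nat.le_succ n) η) (i : Fin N) :
    ξ.poly i = η.poly i + Polynomial.X ^ (n + 1) *
      Polynomial.C (ξ (i, Fin.last _) - η (i, Fin.last _)) := by
  ext l
  rw [Polynomial.coeff_add, coeff_poly, coeff_poly, Polynomial.coeff_X_pow_mul']
  rcases lt_trichotomy l (n + 1) with hl | rfl | hl
  · have := congrFun h (i, ⟨l, hl⟩)
    have h2 : ξ (i, ⟨l, by omega⟩) = η (i, ⟨l, by omega⟩) := this
    rw [dif_pos (by omega), dif_pos (by omega), if_neg (by omega), h2, add_zero]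
  · simp [Fin.last]
  · rw [dif_neg (by omega), dif_neg (by omega), if_pos (by omega), Polynomial.coeff_C,
      if_neg (by omega), add_zero]

theorem origin_trunc {N n m : ℕ} (h : n ≤ m) (ξ : Jet N m) : (trunc h ξ).origin = ξ.origin := rfl

/-- With `ξ = η + t^(n+1) v`, `f(ξ) ≡ f(η) + t^(n+1) ∇f(η)·v` modulo `t^(2n+2)`, hence modulo
`t^(n+2)`. As `f(η)` vanishes to that order, only the constant term of `∇f(η)·v` matters. -/
theorem mem_jets_iff_mem_tangentSpace {N n : ℕ} (X : Set (Fin N → ℝ)) (ξ η : Jet N (n + 1))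
    (h : trunc (Nat.le_succ n) ξ = trunc (Nat.le_succ n) η) (hη : η ∈ jets X (n + 1)) :
    ξ ∈ jets X (n + 1) ↔
      (fun i => ξ (i, Fin.last _) - η (i, Fin.last _)) ∈ tangentSpace X η.origin := by
  have key : ∀ f ∈ MvPolynomial.vanishingIdeal ℝ X,
      ((Polynomial.X : Polynomial ℝ) ^ (n + 1 + 1) ∣ MvPolynomial.aeval ξ.poly f ↔
        ∑ i, MvPolynomial.eval η.origin (MvPolynomial.pderiv i f) *
          (ξ (i, Fin.last _) - η (i, Fin.last _)) = 0) := by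
    intro f hf
    have h1 := aeval_add_sub_mem_sq (Ideal.span {(Polynomial.X : Polynomial ℝ) ^ (n + 1)}) η.poly
      (fun i => Polynomial.X ^ (n + 1) * Polynomial.C (ξ (i, Fin.last _) - η (i, Fin.last _)))
      (fun i => Ideal.mul_mem_right _ _ (Ideal.mem_span_singleton_self _)) f
    have h0 : (fun i => η.poly i + Polynomial.X ^ (n + 1) *
      Polynomial.C (ξ (i, Fin.last _) - η (i, Fin.last _))) = ξ.poly :=
      funext fun i => (poly_eq_add_of_trunc_eq ξ η h i).symm
    rw [h0, Ideal.span_singleton_pow, Ideal.mem_span_singleton, ← pow_mul] at h1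
    have h2 := (pow_dvd_pow (Polynomial.X : Polynomial ℝ)
      (by omega : n + 1 + 1 ≤ (n + 1) * 2)).trans h1
    have h3 := hη f hf
    have h4 : (Polynomial.X : Polynomial ℝ) ^ (n + 1 + 1) ∣ MvPolynomial.aeval ξ.poly f ↔
        (Polynomial.X : Polynomial ℝ) ^ (n + 1 + 1) ∣ ∑ i, (Polynomial.X ^ (n + 1) *
          Polynomial.C (ξ (i, Fin.last _) - η (i, Fin.last _))) *
            MvPolynomial.aeval η.poly (MvPolynomial.pderiv i f) := by
      rw [sub_sub] at h2
      exact (dvd_iff_dvd_of_dvd_sub h2).trans (dvd_add_right h3)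
    rw [h4]
    simp only [mul_assoc, ← Finset.mul_sum]
    rw [pow_succ, mul_dvd_mul_iff_left (pow_ne_zero _ Polynomial.X_ne_zero), Polynomial.X_dvd_iff,
      Polynomial.coeff_zero_eq_eval_zero, Polynomial.eval_finsetSum]
    simp only [Polynomial.eval_mul, Polynomial.eval_C, eval_zero_aeval_poly]
    simp only [mul_comm]
  constructor
  · intro hξ f hf
    exact (key f hf).mp (hξ f hf)
  · intro hξ f hf
    exact (key f hf).mpr (hξ f hf)

/-- Any jet `η` of the fibre serves as origin: only the last coefficient is free, and its difference
from that of `η` ranges over the tangent space. -/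
theorem jets_fibre_affinelyIsomorphic {N : ℕ} (X : Set (Fin N → ℝ)) (n : ℕ) (γ : Jet N n) :
    {ξ | ξ ∈ jets X (n + 1) ∧ trunc (Nat.le_succ n) ξ = γ} = ∅ ∨
      AffinelyIsomorphic {ξ | ξ ∈ jets X (n + 1) ∧ trunc (Nat.le_succ n) ξ = γ}
        (tangentSpace X γ.origin : Set (Fin N → ℝ)) := by
  classical
  rcases Set.eq_empty_or_nonempty {ξ | ξ ∈ jets X (n + 1) ∧ trunc (Nat.le_succ n) ξ = γ}
    with h | ⟨η, hη, rfl⟩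
  · exact Or.inl h
  right
  rw [origin_trunc]
  let L : Jet N (n + 1) →ₗ[ℝ] (Fin N → ℝ) := LinearMap.funLeft ℝ ℝ fun i => (i, Fin.last _)
  let M : (Fin N → ℝ) →ₗ[ℝ] Jet N (n + 1) :=
    LinearMap.pi fun p => if p.2 = Fin.last _ then LinearMap.proj p.1 else 0
  have hM1 : ∀ v i, M v (i, Fin.last _) = v i := fun v i => by simp [M]
  have hM2 : ∀ v i k, k ≠ Fin.last _ → M v (i, k) = 0 := fun v i k hk => by simp [M, hk]
  have hcast : ∀ k : Fin (n + 1), Fin.castLE (by omega : n + 1 ≤ n + 1 + 1) k ≠ Fin.last _ := by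
    intro k hk
    have := congrArg Fin.val hk
    simp at this
    omega
  refine ⟨L.toAffineMap - AffineMap.const ℝ _ (L η), M.toAffineMap + AffineMap.const ℝ _ η,
    ?_, ?_, ?_, ?_⟩
  · rintro ξ ⟨hξ, hξη⟩
    exact (mem_jets_iff_mem_tangentSpace X ξ η hξη hη).mp hξ
  · intro v hv
    have htr : trunc (Nat.le_succ n) (M v + η) = trunc (Nat.le_succ n) η := by
      funext p
      change M v (p.1, _) + η (p.1, _) = η (p.1, _)
      rw [hM2 _ _ _ (hcast p.2), zero_add]
    refine ⟨(mem_jets_iff_mem_tangentSpace X _ η htr hη).mpr ?_, htr⟩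
    have hv' : (fun i => (M v + η) (i, Fin.last _) - η (i, Fin.last _)) = v := by
      funext i
      change M v (i, _) + η (i, _) - η (i, _) = v i
      rw [hM1]; ring
    rw [hv']; exact hv
  · rintro ξ ⟨hξ, hξη⟩
    funext ⟨i, k⟩
    change M (L ξ - L η) (i, k) + η (i, k) = ξ (i, k)
    by_cases hk : k = Fin.last _
    · subst hk
      rw [hM1]
      change ξ (i, _) - η (i, _) + η (i, _) = _
      ring
    · rw [hM2 _ _ _ hk, zero_add]
      have hk' : (k : ℕ) < n + 1 := by
        have := Fin.val_lt_last hk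
        exact this
      have := congrFun hξη (i, ⟨k, hk'⟩)
      exact this.symm
  · intro v hv
    funext i
    change M v (i, _) + η (i, _) - η (i, _) = v i
    rw [hM1]; ring

end Taylor

/-! ### Taylor series of analytic arcs; the upper bounds for liftable jets. -/

section Analytic

/-- The Taylor series at `0`. -/
noncomputable def taylorSeries (g : ℝ → ℝ) : PowerSeries ℝ :=
  PowerSeries.mk fun n => iteratedDeriv n g 0 / (Nat.factorial n : ℝ)

theorem taylorSeries_congr {g h : ℝ → ℝ} (hgh : g =ᶠ[𝓝 0] h) :
    taylorSeries g = taylorSeries h := by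
  ext n
  simp only [taylorSeries, PowerSeries.coeff_mk]
  rw [hgh.iteratedDeriv_eq n]

theorem taylorSeries_const (r : ℝ) : taylorSeries (fun _ => r) = PowerSeries.C r := by
  ext n
  simp only [taylorSeries, PowerSeries.coeff_mk, PowerSeries.coeff_C, iteratedDeriv_const]
  split_ifs with h <;> simp [h]

theorem taylorSeries_add {g h : ℝ → ℝ} (hg : AnalyticAt ℝ g 0) (hh : AnalyticAt ℝ h 0) :
    taylorSeries (fun t => g t + h t) = taylorSeries g + taylorSeries h := by
  ext n
  simp only [taylorSeries, PowerSeries.coeff_mk, map_add]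
  rw [← add_div]
  congr 1
  exact iteratedDeriv_fun_add hg.contDiffAt hh.contDiffAt

theorem taylorSeries_mul {g h : ℝ → ℝ} (hg : AnalyticAt ℝ g 0) (hh : AnalyticAt ℝ h 0) :
    taylorSeries (fun t => g t * h t) = taylorSeries g * taylorSeries h := by
  ext n
  simp only [taylorSeries, PowerSeries.coeff_mk, PowerSeries.coeff_mul]
  rw [iteratedDeriv_fun_mul hg.contDiffAt hh.contDiffAt,
    Finset.Nat.sum_antidiagonal_eq_sum_range_succ_mk, Finset.sum_div]
  refine Finset.sum_congr rfl fun i hi => ?_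
  have hi' : i ≤ n := by simpa [Nat.lt_succ_iff] using hi
  rw [Nat.cast_choose ℝ hi']
  have h1 : (n.factorial : ℝ) ≠ 0 := by positivity
  have h2 : (i.factorial : ℝ) ≠ 0 := by positivity
  have h3 : ((n - i).factorial : ℝ) ≠ 0 := by positivity
  field_simp

theorem taylorSeries_id : taylorSeries (fun t => t) = PowerSeries.X := by
  ext n
  simp only [taylorSeries, PowerSeries.coeff_mk, PowerSeries.coeff_X]
  rcases n with _ | _ | n
  · simp
  · simp [iteratedDeriv_one]
  · rw [if_neg (by omega)]
    have : iteratedDeriv (n + 1 + 1) (fun t : ℝ => t) 0 = 0 := by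
      rw [iteratedDeriv_succ', show deriv (fun t : ℝ => t) = fun _ => 1 by funext; simp,
        iteratedDeriv_const]
      simp
    simp [this]

theorem analyticAt_eval {σ : Type*} {γ : ℝ → σ → ℝ} (hγ : ∀ i, AnalyticAt ℝ (fun t => γ t i) 0)
    (f : MvPolynomial σ ℝ) : AnalyticAt ℝ (fun t => MvPolynomial.eval (γ t) f) 0 := by
  simpa [MvPolynomial.aeval_eq_eval] using AnalyticAt.aeval_mvPolynomial hγ f

theorem taylorSeries_eval {σ : Type*} {γ : ℝ → σ → ℝ}
    (hγ : ∀ i, AnalyticAt ℝ (fun t => γ t i) 0) (f : MvPolynomial σ ℝ) :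
    taylorSeries (fun t => MvPolynomial.eval (γ t) f) =
      MvPolynomial.aeval (fun i => taylorSeries fun t => γ t i) f := by
  induction f using MvPolynomial.induction_on with
  | C r => simp [taylorSeries_const]
  | add p q hp hq =>
    simp only [map_add]
    rw [taylorSeries_add (analyticAt_eval hγ p) (analyticAt_eval hγ q), hp, hq]
  | mul_X p i hp =>
    simp only [map_mul, MvPolynomial.eval_X, MvPolynomial.aeval_X]
    rw [taylorSeries_mul (analyticAt_eval hγ p) (hγ i), hp]

theorem arcJet_apply {N : ℕ} (n : ℕ) (γ : ℝ → Fin N → ℝ) (i : Fin N) (k : Fin (n + 1)) :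
    arcJet n γ (i, k) = PowerSeries.coeff (k : ℕ) (taylorSeries fun t => γ t i) := by
  simp [arcJet, taylorSeries]

theorem analyticAt_pi_apply {N : ℕ} {γ : ℝ → Fin N → ℝ} (hγ : AnalyticAt ℝ γ 0) (i : Fin N) :
    AnalyticAt ℝ (fun t => γ t i) 0 :=
  analyticAt_pi_iff.mp hγ i

theorem aeval_taylorSeries_eq_zero {N : ℕ} {X : Set (Fin N → ℝ)} {γ : ℝ → Fin N → ℝ}
    (hγ : IsArcOn X γ) {f : MvPolynomial (Fin N) ℝ} (hf : f ∈ MvPolynomial.vanishingIdeal ℝ X) :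
    MvPolynomial.aeval (fun i => taylorSeries fun t => γ t i) f = 0 := by
  rw [← taylorSeries_eval (analyticAt_pi_apply hγ.1) f, taylorSeries_congr (hγ.2 f hf),
    taylorSeries_const, map_zero]

theorem X_pow_dvd_coe_iff {n : ℕ} (p : Polynomial ℝ) :
    (PowerSeries.X : PowerSeries ℝ) ^ n ∣ (p : PowerSeries ℝ) ↔ Polynomial.X ^ n ∣ p := by
  rw [PowerSeries.X_pow_dvd_iff, Polynomial.X_pow_dvd_iff]
  simp

theorem coe_aeval_poly {σ : Type*} (p : σ → Polynomial ℝ) (f : MvPolynomial σ ℝ) :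
    ((MvPolynomial.aeval p f : Polynomial ℝ) : PowerSeries ℝ) =
      MvPolynomial.aeval (fun i => (p i : PowerSeries ℝ)) f :=
  MvPolynomial.comp_aeval_apply p (Polynomial.coeToPowerSeries.algHom ℝ) f |>.trans (by simp)

theorem X_pow_dvd_taylorSeries_sub_poly_arcJet {N : ℕ} (n : ℕ) (γ : ℝ → Fin N → ℝ) (i : Fin N) :
    (PowerSeries.X : PowerSeries ℝ) ^ (n + 1) ∣
      ((arcJet n γ).poly i : PowerSeries ℝ) - taylorSeries fun t => γ t i := by
  rw [PowerSeries.X_pow_dvd_iff]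
  intro l hl
  rw [map_sub, Polynomial.coeff_coe, coeff_poly, dif_pos hl, arcJet_apply, sub_self]

theorem liftableJets_subset_jets {N : ℕ} (X : Set (Fin N → ℝ)) (n : ℕ) :
    liftableJets X n ⊆ jets X n := by
  rintro _ ⟨γ, hγ, rfl⟩ f hf
  rw [← X_pow_dvd_coe_iff, coe_aeval_poly]
  have h := aeval_sub_aeval_mem (Ideal.span {(PowerSeries.X : PowerSeries ℝ) ^ (n + 1)}) _ _
    (fun i => Ideal.mem_span_singleton.mpr (X_pow_dvd_taylorSeries_sub_poly_arcJet n γ i)) f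
  rw [aeval_taylorSeries_eq_zero hγ hf, sub_zero] at h
  exact Ideal.mem_span_singleton.mp h

/-- The dimension is monotone. -/
theorem dim_mono {σ : Type*} {A B : Set (σ → ℝ)} (h : A ⊆ B) : dim A ≤ dim B :=
  ringKrullDim_le_of_surjective
    (Ideal.Quotient.factor (MvPolynomial.vanishingIdeal_anti_mono h))
    (Ideal.Quotient.factor_surjective _)

theorem dim_liftableJets_le {N d : ℕ} {X : Set (Fin N → ℝ)} (hd : dim X = (d : WithBot ℕ∞))
    (n : ℕ) : dim (liftableJets X n) ≤ (((n + 1) * d : ℕ) : WithBot ℕ∞) := by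
  refine dim_le_of_formal_arcs hd _ 0 (n + 1) (by omega) ?_ (fun _ _ h => absurd h (by omega))
  rintro _ ⟨γ, hγ, rfl⟩
  exact ⟨_, fun f hf => aeval_taylorSeries_eq_zero hγ hf, fun i k => (arcJet_apply n γ i k).symm⟩

theorem dim_fibre_liftableJets_le {N d : ℕ} {X : Set (Fin N → ℝ)}
    (hd : dim X = (d : WithBot ℕ∞)) {n m : ℕ} (h : n ≤ m) (γ : Jet N n) :
    dim {ξ | ξ ∈ liftableJets X m ∧ trunc h ξ = γ} ≤ (((m - n) * d : ℕ) : WithBot ℕ∞) := by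
  -- On the fibre, the `n + 1` coefficients of order at most `n` are those of `γ`.
  refine dim_le_of_formal_arcs hd _ (n + 1) (m - n) (by omega) ?_ ?_
  · rintro _ ⟨⟨γ, hγ, rfl⟩, -⟩
    exact ⟨_, fun f hf => aeval_taylorSeries_eq_zero hγ hf,
      fun i k => (arcJet_apply m γ i k).symm⟩
  · intro i k hk
    exact ⟨γ (i, ⟨k, hk⟩), fun ξ hξ => congrFun hξ.2 (i, ⟨k, hk⟩)⟩

end Analytic

/-! ### Gradients and local analytic coordinates. -/

section LocalCoordinates

/-- The gradient at `x` of a polynomial. -/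
noncomputable def gradient {N : ℕ} (x : Fin N → ℝ) :
    MvPolynomial (Fin N) ℝ →ₗ[ℝ] (Fin N → ℝ) where
  toFun f i := MvPolynomial.eval x (MvPolynomial.pderiv i f)
  map_add' f g := by funext i; simp
  map_smul' c f := by funext i; simp

theorem gradient_apply {N : ℕ} (x : Fin N → ℝ) (f : MvPolynomial (Fin N) ℝ) (i : Fin N) :
    gradient x f i = MvPolynomial.eval x (MvPolynomial.pderiv i f) := rfl

theorem gradient_mul {N : ℕ} (x : Fin N → ℝ) (f g : MvPolynomial (Fin N) ℝ) :
    gradient x (f * g) = MvPolynomial.eval x f • gradient x g +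
      MvPolynomial.eval x g • gradient x f := by
  funext i
  simp only [gradient_apply, MvPolynomial.pderiv_mul, map_add, map_mul, Pi.add_apply,
    Pi.smul_apply, smul_eq_mul]
  ring

/-- The ideal of polynomials vanishing at `x`. -/
noncomputable abbrev pointIdeal {N : ℕ} (x : Fin N → ℝ) : Ideal (MvPolynomial (Fin N) ℝ) :=
  RingHom.ker (MvPolynomial.eval x)

/-- Taylor's formula at the constants `x i` with increments `X i - x i`, which lie in the ideal of
the point. -/
theorem sub_mem_pointIdeal_sq {N : ℕ} (x : Fin N → ℝ) (f : MvPolynomial (Fin N) ℝ)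
    (h0 : MvPolynomial.eval x f = 0) (h1 : gradient x f = 0) : f ∈ pointIdeal x ^ 2 := by
  have h := aeval_add_sub_mem_sq (pointIdeal x)
    (fun i => (MvPolynomial.C (x i) : MvPolynomial (Fin N) ℝ))
    (fun i => MvPolynomial.X i - MvPolynomial.C (x i)) (fun i => by simp [RingHom.mem_ker]) f
  have hC : ∀ g : MvPolynomial (Fin N) ℝ, MvPolynomial.aeval
      (fun i => (MvPolynomial.C (x i) : MvPolynomial (Fin N) ℝ)) g =
        MvPolynomial.C (MvPolynomial.eval x g) := by
    intro g
    have : MvPolynomial.aeval (fun i => (MvPolynomial.C (x i) : MvPolynomial (Fin N) ℝ)) =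
        (Algebra.ofId ℝ (MvPolynomial (Fin N) ℝ)).comp (MvPolynomial.aeval x) := by
      ext; simp [Algebra.ofId_apply, MvPolynomial.algebraMap_eq]
    rw [this]
    simp [Algebra.ofId_apply, MvPolynomial.algebraMap_eq, MvPolynomial.aeval_eq_eval]
  simp only [hC, h0, map_zero, sub_zero] at h
  have h2 : ∀ i, MvPolynomial.eval x (MvPolynomial.pderiv i f) = 0 := fun i => congrFun h1 i
  simpa [h2] using h

theorem hasFDerivAt_eval {N : ℕ} (x : Fin N → ℝ) (f : MvPolynomial (Fin N) ℝ) :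
    HasFDerivAt (fun y => MvPolynomial.eval y f)
      (∑ l, gradient x f l • (ContinuousLinearMap.proj l : (Fin N → ℝ) →L[ℝ] ℝ)) x := by
  induction f using MvPolynomial.induction_on with
  | C r =>
    have : gradient x (MvPolynomial.C r) = 0 := by funext i; simp [gradient_apply]
    simpa [this] using hasFDerivAt_const r x
  | add p q hp hq =>
    simp only [map_add, Pi.add_apply, add_smul, Finset.sum_add_distrib]
    exact hp.add hq
  | mul_X p i hp =>
    have hX : gradient x (MvPolynomial.X i) = Pi.single i 1 := by
      funext l
      simp [gradient_apply, MvPolynomial.pderiv_X, Pi.single_apply, apply_ite, eq_comm]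
    have h1 : HasFDerivAt (fun y : Fin N → ℝ => y i)
        (ContinuousLinearMap.proj i : (Fin N → ℝ) →L[ℝ] ℝ) x :=
      (ContinuousLinearMap.proj i : (Fin N → ℝ) →L[ℝ] ℝ).hasFDerivAt
    have h2 := hp.fun_mul h1
    simp only [map_mul, MvPolynomial.eval_X]
    refine h2.congr_fderiv ?_
    rw [gradient_mul, hX]
    ext w
    simp [add_mul, Finset.sum_add_distrib, Finset.mul_sum, Pi.single_apply, mul_assoc]

theorem eq_zero_of_basis_dotProduct {N : ℕ} {ι : Type*} (b : Module.Basis ι ℝ (Fin N → ℝ))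
    {w : Fin N → ℝ} (hw : ∀ i, (∑ l, b i l * w l) = 0) : w = 0 := by
  let L : (Fin N → ℝ) →ₗ[ℝ] ℝ := ∑ l, w l • LinearMap.proj l
  have hL : L = 0 := b.ext fun i => by
    simpa [L, mul_comm] using hw i
  funext l
  have := congrArg (fun φ => φ (Pi.single l 1)) hL
  simpa [L, Pi.single_apply] using this

/-- Polynomials with independent gradients form local analytic coordinates. -/
theorem exists_local_inverse {N : ℕ} {ι : Type*} [Fintype ι] (x : Fin N → ℝ)
    (P : ι → MvPolynomial (Fin N) ℝ) (hP0 : ∀ i, MvPolynomial.eval x (P i) = 0)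
    (b : Module.Basis ι ℝ (Fin N → ℝ)) (hb : ∀ i, b i = gradient x (P i)) :
    ∃ Ψ : (ι → ℝ) → (Fin N → ℝ), AnalyticAt ℝ Ψ 0 ∧ Ψ 0 = x ∧
      ∀ᶠ u in 𝓝 (0 : ι → ℝ), ∀ i, MvPolynomial.eval (Ψ u) (P i) = u i := by
  let Φ : (Fin N → ℝ) → (ι → ℝ) := fun y i => MvPolynomial.eval y (P i)
  have hΦx : Φ x = 0 := funext hP0
  have hΦa : AnalyticAt ℝ Φ x := by
    refine analyticAt_pi_iff.mpr fun i => ?_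
    exact AnalyticOnNhd.eval_mvPolynomial (P i) x trivial
  let D : (Fin N → ℝ) →L[ℝ] (ι → ℝ) := ContinuousLinearMap.pi fun i =>
    ∑ l, gradient x (P i) l • (ContinuousLinearMap.proj l : (Fin N → ℝ) →L[ℝ] ℝ)
  have hD : HasFDerivAt Φ D x := hasFDerivAt_pi.mpr fun i => hasFDerivAt_eval x (P i)
  -- The rows of the Jacobian matrix are the basis vectors `b i`.
  have hDinj : Function.Injective D := by
    rw [injective_iff_map_eq_zero]
    intro w hw
    refine eq_zero_of_basis_dotProduct b fun i => ?_
    have := congrFun hw i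
    simpa [D, hb] using this
  have hcard : Module.finrank ℝ (Fin N → ℝ) = Module.finrank ℝ (ι → ℝ) := by
    rw [Module.finrank_eq_card_basis b, Module.finrank_fintype_fun_eq_card]
  let D' : (Fin N → ℝ) ≃L[ℝ] (ι → ℝ) :=
    (LinearEquiv.ofInjectiveOfFinrankEq D.toLinearMap hDinj hcard).toContinuousLinearEquiv
  have hD' : (D' : (Fin N → ℝ) →L[ℝ] (ι → ℝ)) = D := by ext; rfl
  have hst : HasStrictFDerivAt Φ (D' : (Fin N → ℝ) →L[ℝ] (ι → ℝ)) x := by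
    rw [hD', ← hD.fderiv]
    exact hΦa.hasStrictFDerivAt
  let e := hst.toOpenPartialHomeomorph Φ
  have hxe : x ∈ e.source := hst.mem_toOpenPartialHomeomorph_source
  have hes : AnalyticAt ℝ e.symm (e x) :=
    e.analyticAt_symm' (i := D') hxe hΦa hst.hasFDerivAt.fderiv
  have hex : e x = 0 := hΦx
  refine ⟨e.symm, hex ▸ hes, ?_, ?_⟩
  · rw [← hex]; exact e.left_inv hxe
  · have : ∀ᶠ u in 𝓝 (0 : ι → ℝ), u ∈ e.target := by
      rw [← hex]; exact e.open_target.mem_nhds (e.map_source hxe)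
    filter_upwards [this] with u hu i
    exact congrFun (e.right_inv hu) i

end LocalCoordinates

/-! ### Order of vanishing along a smooth formal curve. -/

section OrderAlongCurve

variable {N : ℕ} {x : Fin N → ℝ} {l : MvPolynomial (Fin N) ℝ} {J : Ideal (MvPolynomial (Fin N) ℝ)}

/-- The hypothesis `hM` says that `l` spans the cotangent space modulo the equations `J`;
multiplying it by itself `e` times leaves only `l ^ e` in degree `e`. -/
theorem pointIdeal_pow_le (hl : l ∈ pointIdeal x)
    (hM : pointIdeal x ≤ Ideal.span {l} ⊔ J ⊔ pointIdeal x ^ 2) (e : ℕ) :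
    pointIdeal x ^ e ≤ Ideal.span {l ^ e} ⊔ J ⊔ pointIdeal x ^ (e + 1) := by
  induction e with
  | zero => simp
  | succ e ih =>
    have h1 : Ideal.span {l ^ e} * pointIdeal x ≤
        Ideal.span {l ^ (e + 1)} ⊔ J ⊔ pointIdeal x ^ (e + 1 + 1) := by
      refine (Ideal.mul_mono_right hM).trans ?_
      rw [Ideal.mul_sup, Ideal.mul_sup, Ideal.span_singleton_mul_span_singleton, ← pow_succ]
      refine sup_le (sup_le ?_ ?_) ?_
      · exact le_sup_left.trans le_sup_left
      · exact Ideal.mul_le_right.trans (le_sup_right.trans le_sup_left)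
      · refine le_trans ?_ le_sup_right
        rw [show e + 1 + 1 = e + 2 by ring, pow_add]
        exact Ideal.mul_mono_left (by
          rw [Ideal.span_singleton_le_iff_mem]; exact Ideal.pow_mem_pow hl e)
    rw [pow_succ]
    refine (Ideal.mul_mono_left ih).trans ?_
    rw [Ideal.sup_mul, Ideal.sup_mul, ← pow_succ]
    exact sup_le (sup_le h1 (Ideal.mul_le_left.trans (le_sup_right.trans le_sup_left)))
      le_sup_right

variable {y : Fin N → PowerSeries ℝ}

theorem constantCoeff_aeval (hy : ∀ i, PowerSeries.constantCoeff (y i) = x i)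
    (g : MvPolynomial (Fin N) ℝ) :
    PowerSeries.constantCoeff (MvPolynomial.aeval y g) = MvPolynomial.eval x g := by
  induction g using MvPolynomial.induction_on with
  | C r => simp
  | add p q hp hq => simp only [map_add, hp, hq]
  | mul_X p i hp => simp only [map_mul, hp, MvPolynomial.aeval_X, MvPolynomial.eval_X, hy]

theorem aeval_pointIdeal_pow (hy : ∀ i, PowerSeries.constantCoeff (y i) = x i) (e : ℕ)
    {g : MvPolynomial (Fin N) ℝ} (hg : g ∈ pointIdeal x ^ e) :
    PowerSeries.X ^ e ∣ MvPolynomial.aeval y g := by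
  have h1 : (pointIdeal x).map (MvPolynomial.aeval y : _ →ₐ[ℝ] PowerSeries ℝ) ≤
      Ideal.span {PowerSeries.X} := by
    rw [Ideal.map_le_iff_le_comap]
    intro f hf
    rw [Ideal.mem_comap, Ideal.mem_span_singleton, PowerSeries.X_dvd_iff, ]
    exact (constantCoeff_aeval hy f).trans hf
  have h2 := Ideal.mem_map_of_mem (MvPolynomial.aeval y : _ →ₐ[ℝ] PowerSeries ℝ) hg
  rw [Ideal.map_pow] at h2
  have h3 := Ideal.pow_right_mono h1 e h2
  rwa [Ideal.span_singleton_pow, Ideal.mem_span_singleton] at h3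

/-- An ideal which does not vanish along a smooth formal curve contains, up to the equations `J`
of the curve and terms of higher order, a power of the ideal of the origin of the curve. -/
theorem exists_pointIdeal_pow_le (hl : l ∈ pointIdeal x)
    (hM : pointIdeal x ≤ Ideal.span {l} ⊔ J ⊔ pointIdeal x ^ 2)
    (hy : ∀ i, PowerSeries.constantCoeff (y i) = x i)
    (hyl : MvPolynomial.aeval y l = PowerSeries.X) (hyJ : ∀ g ∈ J, MvPolynomial.aeval y g = 0)
    (I : Ideal (MvPolynomial (Fin N) ℝ)) {g : MvPolynomial (Fin N) ℝ} (hgI : g ∈ I)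
    (hg : MvPolynomial.aeval y g ≠ 0) :
    ∃ e, pointIdeal x ^ e ≤ J ⊔ I ⊔ pointIdeal x ^ (e + 1) := by
  -- Membership in `J ⊔ pointIdeal x ^ e` is equivalent to order at least `e` along the curve
  -- (`hdvd`, `hmem`). If `f` equals `h * l ^ e` up to `J ⊔ pointIdeal x ^ (e + 1)`, its coefficient
  -- of order `e` along the curve is `h(x)`.
  have hdec : ∀ e (f : MvPolynomial (Fin N) ℝ), f ∈ J ⊔ pointIdeal x ^ e →
      ∃ h, f - h * l ^ e ∈ J ⊔ pointIdeal x ^ (e + 1) := by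
    intro e f hf
    have h1 : f ∈ Ideal.span {l ^ e} ⊔ (J ⊔ pointIdeal x ^ (e + 1)) := by
      rw [← sup_assoc]
      exact (sup_le (le_sup_right.trans le_sup_left) (pointIdeal_pow_le hl hM e)) hf
    obtain ⟨p, hp, q, hq, rfl⟩ := Submodule.mem_sup.mp h1
    obtain ⟨h, rfl⟩ := Ideal.mem_span_singleton'.mp hp
    exact ⟨h, by simpa using hq⟩
  have hdvd : ∀ e (f : MvPolynomial (Fin N) ℝ), f ∈ J ⊔ pointIdeal x ^ e →
      PowerSeries.X ^ e ∣ MvPolynomial.aeval y f := by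
    intro e f hf
    obtain ⟨p, hp, q, hq, rfl⟩ := Submodule.mem_sup.mp hf
    rw [map_add, hyJ p hp, zero_add]
    exact aeval_pointIdeal_pow hy e hq
  have hstep : ∀ e (f h : MvPolynomial (Fin N) ℝ), f - h * l ^ e ∈ J ⊔ pointIdeal x ^ (e + 1) →
      PowerSeries.coeff e (MvPolynomial.aeval y f) = MvPolynomial.eval x h := by
    intro e f h hf
    have h1 := hdvd _ _ hf
    rw [PowerSeries.X_pow_dvd_iff] at h1
    have h2 := h1 e (Nat.lt_succ_self e)
    rw [map_sub, map_mul, map_pow, hyl, map_sub, sub_eq_zero] at h2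
    rw [h2, ← constantCoeff_aeval hy h]
    have := PowerSeries.coeff_mul_X_pow (MvPolynomial.aeval y h) e 0
    rw [zero_add] at this
    rw [this, PowerSeries.coeff_zero_eq_constantCoeff_apply]
  have hmem : ∀ e (f : MvPolynomial (Fin N) ℝ), PowerSeries.X ^ e ∣ MvPolynomial.aeval y f →
      f ∈ J ⊔ pointIdeal x ^ e := by
    intro e
    induction e with
    | zero => intro f _; simp
    | succ e ih =>
      intro f hf
      obtain ⟨h, hh⟩ := hdec e f (ih f ((pow_dvd_pow _ (Nat.le_succ e)).trans hf))
      have h1 := hstep e f h hh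
      rw [PowerSeries.X_pow_dvd_iff.mp hf e (Nat.lt_succ_self e)] at h1
      have h2 : h * l ^ e ∈ pointIdeal x ^ (e + 1) := by
        rw [pow_succ']
        exact Ideal.mul_mem_mul (show h ∈ pointIdeal x from h1.symm) (Ideal.pow_mem_pow hl e)
      have := add_mem hh (Ideal.mem_sup_right (S := J) h2)
      simpa using this
  -- At the exact order `e` of `g`, the coefficient `h(x)` is nonzero, so `g` can be solved for `l ^
  -- e` to leading order.
  let e := (MvPolynomial.aeval y g).order.toNat
  have he : PowerSeries.coeff e (MvPolynomial.aeval y g) ≠ 0 := PowerSeries.coeff_order hg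
  have hed : PowerSeries.X ^ e ∣ MvPolynomial.aeval y g := PowerSeries.X_pow_order_dvd
  refine ⟨e, (pointIdeal_pow_le hl hM e).trans (sup_le (sup_le ?_ ?_) le_sup_right)⟩
  · rw [Ideal.span_singleton_le_iff_mem]
    obtain ⟨h, hh⟩ := hdec e g (hmem e g hed)
    have h1 := hstep e g h hh
    rw [h1] at he
    have h2 : (MvPolynomial.C (MvPolynomial.eval x h) - h) * l ^ e ∈ pointIdeal x ^ (e + 1) := by
      rw [pow_succ']
      exact Ideal.mul_mem_mul (by simp [RingHom.mem_ker]) (Ideal.pow_mem_pow hl e)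
    have hle : J ⊔ pointIdeal x ^ (e + 1) ≤ J ⊔ I ⊔ pointIdeal x ^ (e + 1) :=
      sup_le_sup_right le_sup_left _
    have h3 : MvPolynomial.C (MvPolynomial.eval x h) * l ^ e ∈
        J ⊔ I ⊔ pointIdeal x ^ (e + 1) := by
      have h4 : g ∈ J ⊔ I ⊔ pointIdeal x ^ (e + 1) :=
        Ideal.mem_sup_left (Ideal.mem_sup_right hgI)
      have h5 := add_mem (sub_mem h4 (hle hh)) (Ideal.mem_sup_right (S := J ⊔ I) h2)
      convert h5 using 1
      ring
    have h6 := Ideal.mul_mem_left _ (MvPolynomial.C (MvPolynomial.eval x h)⁻¹) h3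
    rwa [← mul_assoc, ← MvPolynomial.C_mul, inv_mul_cancel₀ he, MvPolynomial.C_1, one_mul] at h6
  · exact le_sup_left.trans le_sup_left

end OrderAlongCurve

/-! ### Adapted charts and the height of the ideal of a point. -/

section RegularPoints

variable {N : ℕ}

theorem map_pointIdeal (X : Set (Fin N → ℝ)) (x : X) :
    (pointIdeal x.1).map (Ideal.Quotient.mk (MvPolynomial.vanishingIdeal ℝ X)) = idealAt X x := by
  have h : pointIdeal x.1 =
      (idealAt X x).comap (Ideal.Quotient.mk (MvPolynomial.vanishingIdeal ℝ X)) := by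
    ext f
    rw [Ideal.mem_comap, idealAt, RingHom.mem_ker, RingHom.mem_ker]
    rfl
  rw [h, Ideal.map_comap_of_surjective _ Ideal.Quotient.mk_surjective]

theorem vanishingIdeal_le_pointIdeal {X : Set (Fin N → ℝ)} {x : Fin N → ℝ} (hx : x ∈ X) :
    MvPolynomial.vanishingIdeal ℝ X ≤ pointIdeal x := by
  intro f hf
  simpa [RingHom.mem_ker, MvPolynomial.aeval_eq_eval] using hf x hx

/-- Transfers `height_le_of_pow_le_sup` to polynomials: the equations of `X` are free, and only the
elements of `s` are counted. -/
theorem height_idealAt_le (X : Set (Fin N → ℝ)) (x : X) (s : Finset (MvPolynomial (Fin N) ℝ))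
    (hs : ∀ f ∈ s, f ∈ pointIdeal x.1) (e : ℕ)
    (h : pointIdeal x.1 ^ e ≤ Ideal.span (s : Set (MvPolynomial (Fin N) ℝ)) ⊔
      MvPolynomial.vanishingIdeal ℝ X ⊔ pointIdeal x.1 ^ (e + 1)) :
    (idealAt X x).height ≤ s.card := by
  classical
  let π := Ideal.Quotient.mk (MvPolynomial.vanishingIdeal ℝ X)
  have hmap : Ideal.span ((s.image π : Finset (CoordRing X)) : Set (CoordRing X)) =
      (Ideal.span (s : Set (MvPolynomial (Fin N) ℝ))).map π := by
    rw [Ideal.map_span, Finset.coe_image]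
  have h1 : (idealAt X x).height ≤ (s.image π).card := by
    refine height_le_of_pow_le_sup (s.image π) ?_ e ?_
    · rw [hmap, ← map_pointIdeal]
      exact Ideal.map_mono (Ideal.span_le.mpr hs)
    · have h2 := Ideal.map_mono (f := π) h
      rw [Ideal.map_sup, Ideal.map_sup, Ideal.map_pow, Ideal.map_pow, map_pointIdeal,
        Ideal.map_quotient_self, sup_bot_eq] at h2
      rw [hmap]
      exact h2
  exact h1.trans (by exact_mod_cast Finset.card_image_le)

/-- The gradients at `x` of the polynomials vanishing on `X`. -/
noncomputable def conormalSpace (X : Set (Fin N → ℝ)) (x : Fin N → ℝ) :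
    Submodule ℝ (Fin N → ℝ) :=
  ((MvPolynomial.vanishingIdeal ℝ X).restrictScalars ℝ).map (gradient x)

/-- Polynomial coordinates at `x`, consisting of equations of `X` whose gradients form a basis of
the conormal space and of affine-linear functions. -/
structure AdaptedChart (X : Set (Fin N → ℝ)) (x : Fin N → ℝ) where
  codim : ℕ
  dim : ℕ
  P : Fin codim ⊕ Fin dim → MvPolynomial (Fin N) ℝ
  basis : Module.Basis (Fin codim ⊕ Fin dim) ℝ (Fin N → ℝ)
  P_mem : ∀ i, P (Sum.inl i) ∈ MvPolynomial.vanishingIdeal ℝ X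
  eval_P : ∀ i, MvPolynomial.eval x (P i) = 0
  basis_eq : ∀ i, basis i = gradient x (P i)
  P_inr : ∀ j, P (Sum.inr j) =
    ∑ l, MvPolynomial.C (basis (Sum.inr j) l) * (MvPolynomial.X l - MvPolynomial.C (x l))
  codim_eq : codim = Module.finrank ℝ (conormalSpace X x)
  codim_add_dim : codim + dim = N

theorem gradient_linear (x v : Fin N → ℝ) :
    gradient x (∑ l, MvPolynomial.C (v l) * (MvPolynomial.X l - MvPolynomial.C (x l))) = v := by
  classical
  funext i
  simp only [gradient_apply, map_sum, MvPolynomial.pderiv_mul, map_sub, MvPolynomial.pderiv_C,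
    MvPolynomial.pderiv_X, zero_mul, zero_add, sub_zero, map_mul, MvPolynomial.eval_C]
  rw [Finset.sum_eq_single i]
  · simp
  · intro j _ hj
    simp [hj.symm]
  · simp

theorem exists_adaptedChart {X : Set (Fin N → ℝ)} {x : Fin N → ℝ} (hx : x ∈ X) :
    Nonempty (AdaptedChart X x) := by
  obtain ⟨C, hC⟩ := Submodule.exists_isCompl (conormalSpace X x)
  let bG := Module.finBasis ℝ (conormalSpace X x)
  let bC := Module.finBasis ℝ C
  let b : Module.Basis _ ℝ (Fin N → ℝ) :=
    (bG.prod bC).map (Submodule.prodEquivOfIsCompl _ _ hC)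
  have hf : ∀ i, ∃ f ∈ MvPolynomial.vanishingIdeal ℝ X, gradient x f = bG i := by
    intro i
    obtain ⟨f, hf, hfi⟩ := (bG i).2
    exact ⟨f, hf, hfi⟩
  choose f hfI hf using hf
  have hl : ∀ i, b (Sum.inl i) = bG i := by intro i; simp [b]
  have hcard := Module.finrank_eq_card_basis b
  refine ⟨⟨_, _, Sum.elim f fun j => ∑ l, MvPolynomial.C (b (Sum.inr j) l) *
    (MvPolynomial.X l - MvPolynomial.C (x l)), b, fun i => hfI i, ?_, ?_, fun j => rfl, rfl, ?_⟩⟩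
  · rintro (i | j)
    · exact vanishingIdeal_le_pointIdeal hx (hfI i)
    · simp
  · rintro (i | j)
    · rw [hl, Sum.elim_inl, hf]
    · rw [Sum.elim_inr, gradient_linear]
  · simpa using hcard.symm

namespace AdaptedChart

variable {X : Set (Fin N → ℝ)} {x : Fin N → ℝ} (χ : AdaptedChart X x)

/-- Since the gradients of the `P i` form a basis, a linear combination of the `P i` cancels the
linear part of any polynomial vanishing at `x`. -/
theorem pointIdeal_le {K : Ideal (MvPolynomial (Fin N) ℝ)} (hK : ∀ i, χ.P i ∈ K) :
    pointIdeal x ≤ K ⊔ pointIdeal x ^ 2 := by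
  intro g hg
  let h := ∑ i, MvPolynomial.C (χ.basis.repr (gradient x g) i) * χ.P i
  have hh : h ∈ K := sum_mem fun i _ => K.mul_mem_left _ (hK i)
  have h0 : MvPolynomial.eval x (g - h) = 0 := by
    have hg' : MvPolynomial.eval x g = 0 := hg
    simp [h, hg', χ.eval_P]
  have h1 : gradient x (g - h) = 0 := by
    rw [map_sub, sub_eq_zero, map_sum]
    conv_lhs => rw [← χ.basis.sum_repr (gradient x g)]
    refine Finset.sum_congr rfl fun i _ => ?_
    rw [← MvPolynomial.smul_eq_C_mul, map_smul, χ.basis_eq]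
  have := add_mem (Ideal.mem_sup_right (S := K) (sub_mem_pointIdeal_sq x _ h0 h1))
    (Ideal.mem_sup_left (T := pointIdeal x ^ 2) hh)
  simpa using this

theorem height_le (hx : x ∈ X) : (idealAt X ⟨x, hx⟩).height ≤ χ.dim := by
  classical
  refine (height_idealAt_le X ⟨x, hx⟩ (Finset.univ.image fun j => χ.P (Sum.inr j)) ?_ 1 ?_).trans ?_
  · intro f hf
    obtain ⟨j, -, rfl⟩ := Finset.mem_image.mp hf
    exact χ.eval_P _
  · rw [pow_one]
    refine χ.pointIdeal_le ?_
    rintro (i | j)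
    · exact Ideal.mem_sup_right (χ.P_mem i)
    · refine Ideal.mem_sup_left (Ideal.subset_span ?_)
      simp
  · have := Finset.card_image_le (s := (Finset.univ : Finset (Fin χ.dim)))
      (f := fun j => χ.P (Sum.inr j))
    rw [Finset.card_univ, Fintype.card_fin] at this
    exact_mod_cast this

/-- The curve over the line through `u` is cut out by the chart equations in `I(X)` and `dim - 1`
further functions. If `g` did not vanish along it, these functions and `I(X)` together would contain
a power of the maximal ideal to leading order, making its height at most `dim - 1`. -/
theorem taylorSeries_line_eq_zero (hx : x ∈ X) (hdim : (χ.dim : ℕ∞) ≤ (idealAt X ⟨x, hx⟩).height)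
    {Ψ : (Fin χ.codim ⊕ Fin χ.dim → ℝ) → (Fin N → ℝ)} (hΨ : AnalyticAt ℝ Ψ 0) (hΨ0 : Ψ 0 = x)
    (hP : ∀ᶠ u in 𝓝 0, ∀ i, MvPolynomial.eval (Ψ u) (χ.P i) = u i)
    (u : Fin χ.codim ⊕ Fin χ.dim → ℝ) (hu : ∀ i, u (Sum.inl i) = 0)
    {g : MvPolynomial (Fin N) ℝ} (hg : g ∈ MvPolynomial.vanishingIdeal ℝ X) :
    taylorSeries (fun s => MvPolynomial.eval (Ψ (s • u)) g) = 0 := by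
  classical
  have hline : Tendsto (fun s : ℝ => s • u) (𝓝 0) (𝓝 0) := by
    have : Continuous fun s : ℝ => s • u := by fun_prop
    simpa using this.tendsto 0
  by_cases hu0 : ∀ a, u (Sum.inr a) = 0
  · have : u = 0 := by funext i; rcases i with i | i; exacts [hu i, hu0 i]
    subst this
    have h0 : MvPolynomial.eval x g = 0 := vanishingIdeal_le_pointIdeal hx hg
    simp [hΨ0, h0, taylorSeries_const]
  push Not at hu0
  obtain ⟨a, ha⟩ := hu0
  have hcurve : ∀ l, AnalyticAt ℝ (fun s : ℝ => Ψ (s • u) l) 0 := by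
    have h1 : AnalyticAt ℝ (fun s : ℝ => s • u) 0 := by fun_prop
    have h2 : AnalyticAt ℝ (fun s : ℝ => Ψ (s • u)) 0 :=
      AnalyticAt.fun_comp (by simpa using hΨ) h1
    exact analyticAt_pi_apply h2
  let y : Fin N → PowerSeries ℝ := fun l => taylorSeries fun s => Ψ (s • u) l
  have hyeval : ∀ f, taylorSeries (fun s => MvPolynomial.eval (Ψ (s • u)) f) =
      MvPolynomial.aeval y f := taylorSeries_eval hcurve
  have hyP : ∀ i, MvPolynomial.aeval y (χ.P i) = PowerSeries.C (u i) * PowerSeries.X := by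
    intro i
    rw [← hyeval, ← taylorSeries_id, ← taylorSeries_const,
      ← taylorSeries_mul (g := fun _ => u i) (h := fun t => t) analyticAt_const analyticAt_id]
    apply taylorSeries_congr
    filter_upwards [hline.eventually hP] with s hs
    rw [hs i, Pi.smul_apply, smul_eq_mul, mul_comm]
  have hyx : ∀ l, PowerSeries.constantCoeff (y l) = x l := by
    intro l
    rw [← PowerSeries.coeff_zero_eq_constantCoeff_apply]
    simp [y, taylorSeries, hΨ0]
  rw [hyeval]
  by_contra hne
  -- `l` is normalized to restrict to the parameter of the curve. The `dim - 1` elements of `T`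
  -- express that the other tangent coordinates are proportional to `l` with the ratios prescribed
  -- by `u`.
  let l := MvPolynomial.C (u (Sum.inr a))⁻¹ * χ.P (Sum.inr a)
  let T : Finset (MvPolynomial (Fin N) ℝ) := (Finset.univ.erase a).image fun j =>
    χ.P (Sum.inr j) - MvPolynomial.C (u (Sum.inr j)) * l
  let J₀ : Ideal (MvPolynomial (Fin N) ℝ) := Ideal.span (Set.range fun i => χ.P (Sum.inl i))
  have hyl : MvPolynomial.aeval y l = PowerSeries.X := by
    simp only [l, map_mul, hyP, MvPolynomial.aeval_C, PowerSeries.algebraMap_apply]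
    rw [← mul_assoc, Algebra.algebraMap_self_apply, ← map_mul, inv_mul_cancel₀ ha, map_one, one_mul]
  have hl : l ∈ pointIdeal x := Ideal.mul_mem_left _ _ (χ.eval_P _)
  obtain ⟨e, he⟩ := exists_pointIdeal_pow_le (x := x) (l := l) (y := y)
    (J := J₀ ⊔ Ideal.span (T : Set (MvPolynomial (Fin N) ℝ))) hl
    (by
      refine χ.pointIdeal_le ?_
      have hP_a : χ.P (Sum.inr a) = MvPolynomial.C (u (Sum.inr a)) * l := by
        simp only [l]
        rw [← mul_assoc, ← MvPolynomial.C_mul, mul_inv_cancel₀ ha, MvPolynomial.C_1, one_mul]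
      rintro (i | j)
      · exact Ideal.mem_sup_right (Ideal.mem_sup_left (Ideal.subset_span ⟨i, rfl⟩))
      · by_cases hj : j = a
        · rw [hj, hP_a]
          exact Ideal.mem_sup_left (Ideal.mul_mem_left _ _ (Ideal.mem_span_singleton_self l))
        · have h1 : χ.P (Sum.inr j) - MvPolynomial.C (u (Sum.inr j)) * l ∈
              Ideal.span (T : Set (MvPolynomial (Fin N) ℝ)) := by
            apply Ideal.subset_span
            simp only [T, Finset.coe_image, Set.mem_image]
            exact ⟨j, by simp [hj], rfl⟩
          have h2 := add_mem (Ideal.mem_sup_right (S := Ideal.span {l})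
            (Ideal.mem_sup_right (S := J₀) h1))
            (Ideal.mem_sup_left (T := J₀ ⊔ Ideal.span (T : Set (MvPolynomial (Fin N) ℝ)))
              (Ideal.mul_mem_left _ (MvPolynomial.C (u (Sum.inr j)))
                (Ideal.mem_span_singleton_self l)))
          simpa using h2)
    hyx hyl
    (by
      have hle : J₀ ⊔ Ideal.span (T : Set (MvPolynomial (Fin N) ℝ)) ≤
          RingHom.ker (MvPolynomial.aeval y : _ →ₐ[ℝ] PowerSeries ℝ) := by
        refine sup_le (Ideal.span_le.mpr ?_) (Ideal.span_le.mpr ?_)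
        · rintro _ ⟨i, rfl⟩
          change MvPolynomial.aeval y _ = 0
          rw [hyP, hu i, map_zero, zero_mul]
        · intro f hf
          simp only [T, Finset.coe_image, Set.mem_image] at hf
          obtain ⟨j, -, rfl⟩ := hf
          change MvPolynomial.aeval y _ = 0
          rw [map_sub, map_mul, hyl, hyP, MvPolynomial.aeval_C, PowerSeries.algebraMap_apply]
          simp
      exact fun g hg => hle hg)
    (MvPolynomial.vanishingIdeal ℝ X) hg hne
  have hht := height_idealAt_le X ⟨x, hx⟩ T (by
      intro f hf
      obtain ⟨j, -, rfl⟩ := Finset.mem_image.mp hf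
      exact sub_mem (χ.eval_P _) (Ideal.mul_mem_left _ _ hl)) e (by
      refine he.trans (sup_le_sup_right (sup_le (sup_le ?_ le_sup_left) le_sup_right) _)
      refine (Ideal.span_le.mpr ?_).trans le_sup_right
      rintro _ ⟨i, rfl⟩
      exact χ.P_mem i)
  have hT : T.card ≤ χ.dim - 1 := by
    refine Finset.card_image_le.trans ?_
    rw [Finset.card_erase_of_mem (Finset.mem_univ _), Finset.card_univ, Fintype.card_fin]
  have h3 : (χ.dim : ℕ∞) ≤ T.card := hdim.trans hht
  have h4 : χ.dim ≤ T.card := by exact_mod_cast h3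
  have := a.2
  omega

end AdaptedChart

end RegularPoints

/-! ### Parametrization of `X` and lifting of jets. -/

section LiftingJets

variable {N : ℕ}

theorem eventually_eq_zero_of_taylorSeries {a : ℝ → ℝ} (ha : AnalyticAt ℝ a 0)
    (h : taylorSeries a = 0) : ∀ᶠ t in 𝓝 0, a t = 0 := by
  rw [← analyticOrderAt_eq_top, ENat.eq_top_iff_forall_ge]
  intro n
  rw [natCast_le_analyticOrderAt_iff_iteratedDeriv_eq_zero ha]
  intro i _
  have := congrArg (PowerSeries.coeff i) h
  simp only [taylorSeries, PowerSeries.coeff_mk, map_zero, div_eq_zero_iff] at this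
  exact this.resolve_right (by positivity)

theorem taylorSeries_polynomial (p : Polynomial ℝ) :
    taylorSeries (fun t => p.eval t) = (p : PowerSeries ℝ) := by
  have ha : ∀ q : Polynomial ℝ, AnalyticAt ℝ (fun t => q.eval t) 0 := fun q =>
    AnalyticOnNhd.eval_polynomial q 0 trivial
  induction p using Polynomial.induction_on' with
  | add p q hp hq =>
    simp only [Polynomial.eval_add]
    rw [taylorSeries_add (ha p) (ha q), hp, hq, Polynomial.coe_add]
  | monomial n r =>
    induction n with
    | zero => simp [taylorSeries_const]
    | succ n ih =>
      have h : ∀ t : ℝ, (Polynomial.monomial (n + 1) r).eval t =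
          (Polynomial.monomial n r).eval t * t := fun t => by
        simp [pow_succ, mul_assoc]
      simp only [h]
      rw [taylorSeries_mul (h := fun t => t) (ha _) analyticAt_id, ih, taylorSeries_id, ← Polynomial.coe_X,
        ← Polynomial.coe_mul, Polynomial.monomial_mul_X]

namespace AdaptedChart

variable {X : Set (Fin N → ℝ)} {x : Fin N → ℝ} (χ : AdaptedChart X x)

/-- At a point where `X` has the dimension of its tangent space, `X` contains the image of the
tangent space under the inverse of an adapted chart. -/
theorem exists_parametrization (hx : x ∈ X)
    (hdim : (χ.dim : ℕ∞) ≤ (idealAt X ⟨x, hx⟩).height) :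
    ∃ (Ψ : (Fin χ.codim ⊕ Fin χ.dim → ℝ) → (Fin N → ℝ))
      (U : Set (Fin χ.codim ⊕ Fin χ.dim → ℝ)), IsOpen U ∧ 0 ∈ U ∧ Ψ 0 = x ∧
      AnalyticOnNhd ℝ Ψ U ∧ (∀ u ∈ U, ∀ i, MvPolynomial.eval (Ψ u) (χ.P i) = u i) ∧
      ∀ u ∈ U, (∀ i, u (Sum.inl i) = 0) →
        ∀ g ∈ MvPolynomial.vanishingIdeal ℝ X, MvPolynomial.eval (Ψ u) g = 0 := by
  obtain ⟨Ψ, hΨ, hΨ0, hP⟩ := exists_local_inverse x χ.P χ.eval_P χ.basis χ.basis_eq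
  obtain ⟨ε, hε, hball⟩ := Metric.eventually_nhds_iff_ball.mp (hΨ.eventually_analyticAt.and hP)
  refine ⟨Ψ, Metric.ball 0 ε, Metric.isOpen_ball, Metric.mem_ball_self hε, hΨ0,
    fun u hu => (hball u hu).1, fun u hu => (hball u hu).2, fun u hu hu0 g hg => ?_⟩
  -- The function `s ↦ g(Ψ(s u))` is analytic on a convex set containing `0` and `1` and has zero
  -- Taylor series at `0`; the identity theorem gives its vanishing at `s = 1`.
  let L : ℝ →ₗ[ℝ] (Fin χ.codim ⊕ Fin χ.dim → ℝ) := LinearMap.toSpanSingleton ℝ _ u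
  have hS : IsPreconnected (L ⁻¹' Metric.ball 0 ε) :=
    ((convex_ball _ _).linear_preimage L).isPreconnected
  have ha : AnalyticOnNhd ℝ (fun s : ℝ => MvPolynomial.eval (Ψ (s • u)) g)
      (L ⁻¹' Metric.ball 0 ε) := by
    intro s hs
    have h1 : AnalyticAt ℝ (fun s : ℝ => s • u) s := by fun_prop
    have h2 : AnalyticAt ℝ (fun s : ℝ => Ψ (s • u)) s :=
      AnalyticAt.fun_comp (hball _ hs).1 h1
    have h3 : AnalyticAt ℝ (fun y => MvPolynomial.eval y g) (Ψ (s • u)) :=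
      AnalyticOnNhd.eval_mvPolynomial g _ trivial
    exact AnalyticAt.fun_comp (f := fun s : ℝ => Ψ (s • u)) h3 h2
  have h0 : (0 : ℝ) ∈ L ⁻¹' Metric.ball 0 ε := by simp [L, hε]
  have h1 : (1 : ℝ) ∈ L ⁻¹' Metric.ball 0 ε := by simpa [L] using hu
  have h2 := eventually_eq_zero_of_taylorSeries (ha 0 h0)
    (χ.taylorSeries_line_eq_zero hx hdim hΨ hΨ0 hP u hu0 hg)
  have h3 := ha.eqOn_zero_of_preconnected_of_eventuallyEq_zero hS h0 h2 h1
  simpa using h3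

/-- Formal arcs through `x` on which the chart functions agree to order `n` agree to order `n`. -/
theorem X_pow_dvd_sub {y y' : Fin N → PowerSeries ℝ}
    (hy : ∀ i, PowerSeries.constantCoeff (y i) = x i)
    (hy' : ∀ i, PowerSeries.constantCoeff (y' i) = x i) (n : ℕ)
    (h : ∀ i, PowerSeries.X ^ n ∣
      MvPolynomial.aeval y (χ.P i) - MvPolynomial.aeval y' (χ.P i)) (l : Fin N) :
    PowerSeries.X ^ n ∣ y l - y' l := by
  have key : ∀ e, e + 1 ≤ n → ∀ l, PowerSeries.X ^ (e + 1) ∣ y l - y' l := by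
    intro e
    induction e with
    | zero =>
      intro _ l
      rw [zero_add, pow_one, PowerSeries.X_dvd_iff, map_sub, hy, hy', sub_self]
    | succ e ih =>
      intro he
      have ih' := ih (by omega)
      -- Taylor's formula turns agreement of the chart functions into a linear system for `y - y'`.
      -- As `y - y'` is divisible by `t^(e+1)`, only the constant part of the Jacobian, which is the
      -- invertible matrix of `χ.basis`, contributes modulo `t^(e+2)`.
      have h1 : ∀ i, PowerSeries.X ^ (e + 1 + 1) ∣
          ∑ l, (y l - y' l) * PowerSeries.C (χ.basis i l) := by
        intro i
        have h2 := aeval_add_sub_mem_sq (Ideal.span {(PowerSeries.X : PowerSeries ℝ) ^ (e + 1)})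
          y' (fun l => y l - y' l) (fun l => Ideal.mem_span_singleton.mpr (ih' l)) (χ.P i)
        simp only [add_sub_cancel] at h2
        rw [Ideal.span_singleton_pow, Ideal.mem_span_singleton, ← pow_mul] at h2
        have h3 := (pow_dvd_pow (PowerSeries.X : PowerSeries ℝ)
          (by omega : e + 1 + 1 ≤ (e + 1) * 2)).trans h2
        have h4 := (pow_dvd_pow (PowerSeries.X : PowerSeries ℝ) he).trans (h i)
        have h5 : PowerSeries.X ^ (e + 1 + 1) ∣ ∑ l, (y l - y' l) *
            MvPolynomial.aeval y' (MvPolynomial.pderiv l (χ.P i)) := by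
          have := dvd_sub h4 h3
          simpa using this
        have h6 : PowerSeries.X ^ (e + 1 + 1) ∣ ∑ l, (y l - y' l) *
            (MvPolynomial.aeval y' (MvPolynomial.pderiv l (χ.P i)) -
              PowerSeries.C (χ.basis i l)) := by
          refine Finset.dvd_sum fun l _ => ?_
          rw [pow_succ]
          refine mul_dvd_mul (ih' l) ?_
          rw [PowerSeries.X_dvd_iff, map_sub, constantCoeff_aeval hy', χ.basis_eq,
            gradient_apply, PowerSeries.constantCoeff_C, sub_self]
        have := dvd_sub h5 h6
        rw [← Finset.sum_sub_distrib] at this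
        simpa [← mul_sub] using this
      intro l
      rw [PowerSeries.X_pow_dvd_iff]
      intro m hm
      have h7 := eq_zero_of_basis_dotProduct χ.basis
        (w := fun l => PowerSeries.coeff m (y l - y' l)) fun i => by
          have := PowerSeries.X_pow_dvd_iff.mp (h1 i) m hm
          simpa [PowerSeries.coeff_mul_C, mul_comm] using this
      exact congrFun h7 l
  rcases n with _ | n
  · simp
  · exact key n le_rfl l

/-- Analytic arcs in the tangent directions of a chart give analytic arcs on `X`. -/
theorem isArcOn_parametrization
    {Ψ : (Fin χ.codim ⊕ Fin χ.dim → ℝ) → (Fin N → ℝ)}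
    {U : Set (Fin χ.codim ⊕ Fin χ.dim → ℝ)} (hU : IsOpen U) (hΨ : AnalyticOnNhd ℝ Ψ U)
    (hX : ∀ u ∈ U, (∀ i, u (Sum.inl i) = 0) →
        ∀ g ∈ MvPolynomial.vanishingIdeal ℝ X, MvPolynomial.eval (Ψ u) g = 0)
    {ζ : ℝ → Fin χ.dim → ℝ} (hζ : ∀ j, AnalyticAt ℝ (fun t => ζ t j) 0)
    (h0 : Sum.elim (fun _ => 0) (ζ 0) ∈ U) :
    IsArcOn X (fun t => Ψ (Sum.elim (fun _ => 0) (ζ t))) ∧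
      ∀ᶠ t in 𝓝 (0 : ℝ), (Sum.elim (fun _ => 0) (ζ t) : Fin χ.codim ⊕ Fin χ.dim → ℝ) ∈ U := by
  have h1 : AnalyticAt ℝ
      (fun t => (Sum.elim (fun _ => 0) (ζ t) : Fin χ.codim ⊕ Fin χ.dim → ℝ)) 0 := by
    refine analyticAt_pi_iff.mpr ?_
    rintro (i | j)
    · exact analyticAt_const
    · exact hζ j
  have h2 : ∀ᶠ t in 𝓝 (0 : ℝ),
      (Sum.elim (fun _ => 0) (ζ t) : Fin χ.codim ⊕ Fin χ.dim → ℝ) ∈ U :=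
    h1.continuousAt.eventually (hU.mem_nhds h0)
  refine ⟨⟨AnalyticAt.fun_comp (hΨ _ h0) h1, fun f hf => ?_⟩, h2⟩
  filter_upwards [h2] with t ht
  exact hX _ ht (fun i => rfl) f hf

/-- Jets at a point where `X` has the dimension of its tangent space lift to analytic arcs on `X`. -/
theorem mem_liftableJets {n : ℕ} {ξ : Jet N n} (hξ : ξ ∈ jets X n)
    (χ : AdaptedChart X ξ.origin) (hx : ξ.origin ∈ X)
    (hdim : (χ.dim : ℕ∞) ≤ (idealAt X ⟨ξ.origin, hx⟩).height) : ξ ∈ liftableJets X n := by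
  obtain ⟨Ψ, U, hU, h0U, hΨ0, hΨ, hP, hX⟩ := χ.exists_parametrization hx hdim
  let η : ℝ → Fin N → ℝ := fun t l => (ξ.poly l).eval t
  have hη : ∀ l, AnalyticAt ℝ (fun t => η t l) 0 := fun l =>
    AnalyticOnNhd.eval_polynomial (ξ.poly l) 0 trivial
  have hη0 : η 0 = ξ.origin := by
    funext l
    change (ξ.poly l).eval 0 = _
    rw [← Polynomial.coeff_zero_eq_eval_zero, coeff_poly, dif_pos (Nat.succ_pos n)]
    rfl
  -- The lift keeps the tangent coordinates of the polynomial representative and replaces the normal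
  -- ones by zero. The latter are equations of `X`, so on the jet they already vanish modulo
  -- `t^(n+1)`.
  let ζ : ℝ → Fin χ.dim → ℝ := fun t j => MvPolynomial.eval (η t) (χ.P (Sum.inr j))
  have hζ0 : (Sum.elim (fun _ => 0) (ζ 0) : Fin χ.codim ⊕ Fin χ.dim → ℝ) = 0 := by
    funext i
    rcases i with i | j
    · rfl
    · simp only [Sum.elim_inr, ζ, hη0, χ.eval_P]; rfl
  obtain ⟨harc, hev⟩ := χ.isArcOn_parametrization hU hΨ hX
    (ζ := ζ) (fun j => analyticAt_eval hη _) (by rw [hζ0]; exact h0U)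
  set γ : ℝ → Fin N → ℝ := fun t => Ψ (Sum.elim (fun _ => 0) (ζ t)) with hγ
  refine ⟨γ, harc, ?_⟩
  have hη' : (fun l => taylorSeries fun t => η t l) = fun l => (ξ.poly l : PowerSeries ℝ) :=
    funext fun l => taylorSeries_polynomial _
  have hcongr := χ.X_pow_dvd_sub (y := fun l => taylorSeries fun t => γ t l)
    (y' := fun l => taylorSeries fun t => η t l) (fun l => by
      rw [← PowerSeries.coeff_zero_eq_constantCoeff_apply]
      simp [taylorSeries, hγ, hζ0, hΨ0]) (fun l => by
      rw [← PowerSeries.coeff_zero_eq_constantCoeff_apply]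
      simp [taylorSeries, hη0]) (n + 1) (by
      rintro (i | j)
      · rw [aeval_taylorSeries_eq_zero harc (χ.P_mem i), zero_sub, dvd_neg, hη',
          ← coe_aeval_poly, X_pow_dvd_coe_iff]
        exact hξ _ (χ.P_mem i)
      · rw [← taylorSeries_eval (analyticAt_pi_apply harc.1), ← taylorSeries_eval hη]
        have : taylorSeries (fun t => MvPolynomial.eval (γ t) (χ.P (Sum.inr j))) =
            taylorSeries (fun t => MvPolynomial.eval (η t) (χ.P (Sum.inr j))) := by
          apply taylorSeries_congr
          filter_upwards [hev] with t ht
          exact hP _ ht (Sum.inr j)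
        rw [this, sub_self]
        exact dvd_zero _)
  funext ⟨l, k⟩
  have h1 := PowerSeries.X_pow_dvd_iff.mp (hcongr l) k k.2
  rw [map_sub, sub_eq_zero] at h1
  rw [arcJet_apply, h1]
  change PowerSeries.coeff _ (taylorSeries fun t => (ξ.poly l).eval t) = _
  rw [taylorSeries_polynomial, Polynomial.coeff_coe, coeff_poly, dif_pos k.2]

end AdaptedChart

end LiftingJets

/-! ### Regular local rings and the dimension of the tangent space. -/

section TangentDimension

variable {N : ℕ}

/-- The polynomials vanishing at `x` whose gradient at `x` lies in `W`. -/
noncomputable def gradientIdeal (x : Fin N → ℝ) (W : Submodule ℝ (Fin N → ℝ)) :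
    Ideal (MvPolynomial (Fin N) ℝ) where
  carrier := {f | MvPolynomial.eval x f = 0 ∧ gradient x f ∈ W}
  zero_mem' := by simp
  add_mem' := by
    rintro f g ⟨hf, hf'⟩ ⟨hg, hg'⟩
    exact ⟨by simp [hf, hg], by rw [map_add]; exact W.add_mem hf' hg'⟩
  smul_mem' := by
    rintro c f ⟨hf, hf'⟩
    refine ⟨by simp [hf], ?_⟩
    rw [smul_eq_mul, gradient_mul, hf, zero_smul, add_zero]
    exact W.smul_mem _ hf'

theorem gradient_X_sub_C (x : Fin N → ℝ) (l : Fin N) (c : ℝ) :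
    gradient x (MvPolynomial.X l - MvPolynomial.C c) = Pi.single l 1 := by
  funext m
  simp [gradient_apply, MvPolynomial.pderiv_X, Pi.single_apply, apply_ite, eq_comm]

theorem vanishingIdeal_le_gradientIdeal {X : Set (Fin N → ℝ)} {x : Fin N → ℝ} (hx : x ∈ X)
    {W : Submodule ℝ (Fin N → ℝ)} (hW : conormalSpace X x ≤ W) :
    MvPolynomial.vanishingIdeal ℝ X ≤ gradientIdeal x W := fun f hf =>
  ⟨vanishingIdeal_le_pointIdeal hx hf, hW ⟨f, hf, rfl⟩⟩

/-- The conormal space accounts for `codim` of the `N` dimensions, so the vectors `v` must account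
for the rest. -/
theorem AdaptedChart.dim_le_card {X : Set (Fin N → ℝ)} {x : Fin N → ℝ} (χ : AdaptedChart X x)
    {κ : Type*} [Fintype κ] (v : κ → (Fin N → ℝ))
    (h : ∀ l, Pi.single l 1 ∈ conormalSpace X x ⊔ Submodule.span ℝ (Set.range v)) :
    χ.dim ≤ Fintype.card κ := by
  have htop : conormalSpace X x ⊔ Submodule.span ℝ (Set.range v) = ⊤ := by
    rw [eq_top_iff, ← (Pi.basisFun ℝ (Fin N)).span_eq, Submodule.span_le]
    rintro _ ⟨l, rfl⟩
    simpa using h l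
  have h1 := Submodule.finrank_add_le_finrank_add_finrank (conormalSpace X x)
    (Submodule.span ℝ (Set.range v))
  rw [htop, finrank_top, Module.finrank_fin_fun, ← χ.codim_eq] at h1
  have h2 := finrank_range_le_card (R := ℝ) v
  have h3 := χ.codim_add_dim
  unfold Set.finrank at h2
  omega

/-- At a point with regular local ring, the tangent space has the dimension of the local ring. -/
theorem AdaptedChart.dim_le_height_of_isRegularLocalRing {X : Set (Fin N → ℝ)} (x : X)
    (χ : AdaptedChart X x.1)
    (hreg : IsRegularLocalRing (Localization.AtPrime (idealAt X x))) :
    (χ.dim : ℕ∞) ≤ (idealAt X x).height := by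
  let L := Localization.AtPrime (idealAt X x)
  let m := IsLocalRing.maximalIdeal L
  have hk : (m.spanFinrank : WithBot ℕ∞) = (idealAt X x).height := by
    rw [← IsLocalization.AtPrime.ringKrullDim_eq_height (idealAt X x) L]
    exact hreg.spanFinrank_maximalIdeal
  obtain ⟨s, hs, hspan⟩ := (IsNoetherian.noetherian m).exists_span_finset_card_eq_spanFinrank
  have hk' : (s.card : ℕ∞) = (idealAt X x).height := by
    rw [hs]; exact_mod_cast hk
  rw [← hk']
  -- Clearing denominators, a minimal system of generators of the maximal ideal is represented, up
  -- to units, by polynomials `b g`.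
  have hb : ∀ g : s, ∃ b : MvPolynomial (Fin N) ℝ, ∃ t : (idealAt X x).primeCompl,
      (g : L) * algebraMap (CoordRing X) L t =
        algebraMap (CoordRing X) L (Ideal.Quotient.mk _ b) := by
    intro g
    obtain ⟨⟨a, t⟩, hat⟩ := IsLocalization.surj (idealAt X x).primeCompl (g : L)
    obtain ⟨b, rfl⟩ := Ideal.Quotient.mk_surjective a
    exact ⟨b, t, hat⟩
  choose b t hbt using hb
  have hcomap : ∀ a : CoordRing X, algebraMap (CoordRing X) L a ∈ m ↔ a ∈ idealAt X x :=
    fun a => IsLocalization.AtPrime.to_map_mem_maximal_iff L (idealAt X x) a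
  have hb0 : ∀ g, MvPolynomial.eval x.1 (b g) = 0 := by
    intro g
    have h1 : (g : L) ∈ m := by
      rw [← hspan]; exact Submodule.subset_span g.2
    have h2 := Ideal.mul_mem_right (algebraMap (CoordRing X) L (t g)) m h1
    rw [hbt, hcomap] at h2
    exact h2
  let B : Ideal (CoordRing X) := Ideal.span (Set.range fun g => Ideal.Quotient.mk _ (b g))
  have hmB : m ≤ B.map (algebraMap (CoordRing X) L) := by
    rw [← hspan]
    refine Submodule.span_le.mpr fun g hg => ?_
    have hu : IsUnit (algebraMap (CoordRing X) L (t ⟨g, hg⟩)) := IsLocalization.map_units L _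
    have h1 : algebraMap (CoordRing X) L (Ideal.Quotient.mk _ (b ⟨g, hg⟩)) ∈
        B.map (algebraMap (CoordRing X) L) :=
      Ideal.mem_map_of_mem _ (Ideal.subset_span ⟨⟨g, hg⟩, rfl⟩)
    rw [← hbt] at h1
    exact (Ideal.mul_unit_mem_iff_mem _ hu).mp h1
  rw [Nat.cast_le, ← Fintype.card_coe]
  apply χ.dim_le_card (fun g : s => gradient x.1 (b g))
  intro l
  set W := conormalSpace X x.1 ⊔ Submodule.span ℝ (Set.range fun g : s => gradient x.1 (b g))
  let f : MvPolynomial (Fin N) ℝ := MvPolynomial.X l - MvPolynomial.C (x.1 l)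
  have hf : algebraMap (CoordRing X) L (Ideal.Quotient.mk _ f) ∈ m := by
    rw [hcomap, ← map_pointIdeal]
    exact Ideal.mem_map_of_mem _ (by simp [f, RingHom.mem_ker])
  -- Some `h` with `h(x) ≠ 0` brings `h * f` into the ideal of the `b g` modulo `I(X)`, so its
  -- gradient lies in `W`. Because `f(x) = 0`, that gradient is `h(x)` times the `l`-th unit vector.
  obtain ⟨a, ha, haB⟩ := (IsLocalization.algebraMap_mem_map_algebraMap_iff
    (idealAt X x).primeCompl L B _).mp (hmB hf)
  obtain ⟨h, rfl⟩ := Ideal.Quotient.mk_surjective a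
  have hh : MvPolynomial.eval x.1 h ≠ 0 := ha
  have hBW : B ≤ (gradientIdeal x.1 W).map (Ideal.Quotient.mk _) := by
    refine Ideal.span_le.mpr ?_
    rintro _ ⟨g, rfl⟩
    exact Ideal.mem_map_of_mem _ ⟨hb0 g, Submodule.mem_sup_right (Submodule.subset_span ⟨g, rfl⟩)⟩
  have h1 := hBW haB
  rw [← map_mul, Ideal.mem_quotient_iff_mem
    (vanishingIdeal_le_gradientIdeal x.2 le_sup_left)] at h1
  have h2 := h1.2
  rw [gradient_mul, gradient_X_sub_C] at h2
  have h3 : MvPolynomial.eval x.1 f = 0 := by simp [f]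
  rw [h3, zero_smul, add_zero] at h2
  have := W.smul_mem (MvPolynomial.eval x.1 h)⁻¹ h2
  rwa [smul_smul, inv_mul_cancel₀ hh, one_smul] at this

end TangentDimension

/-! ### Existence of a regular point of full dimension. -/

section GenericPoint

variable {N : ℕ}

/-- In a Noetherian ring a minimal prime is the annihilator of some `e`; if `e` were in it, `e ^ 2 =
0` would force `e = 0`. Geometrically, `e` vanishes on the other components but not on that of `P`.
-/
theorem exists_notMem_mul_eq_zero {R : Type*} [CommRing R] [IsNoetherianRing R] [IsReduced R]
    {P : Ideal R} (hP : P ∈ minimalPrimes R) : ∃ e ∉ P, ∀ a ∈ P, e * a = 0 := by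
  have hbot : (⊥ : Submodule R R).colon {(1 : R)} = ⊥ := by
    ext a
    simp [Submodule.mem_colon_singleton]
  obtain ⟨e, he⟩ := Submodule.exists_eq_colon_of_mem_minimalPrimes (N := (⊥ : Submodule R R))
    (x := (1 : R)) (I := P) (by rw [hbot]; exact hP)
  have hmem : ∀ a, a ∈ P ↔ a * e = 0 := by
    intro a
    rw [he, Submodule.mem_colon_singleton, smul_eq_mul, Submodule.mem_bot]
  refine ⟨e, fun heP => hP.1.1.ne_top ?_, fun a ha => by rw [mul_comm]; exact (hmem a).mp ha⟩
  have h0 : e = 0 := by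
    have := (hmem e).mp heP
    exact IsNilpotent.eq_zero ⟨2, by rw [pow_two, this]⟩
  rw [Ideal.eq_top_iff_one, hmem, h0, mul_zero]

theorem isReduced_coordRing (X : Set (Fin N → ℝ)) : IsReduced (CoordRing X) := by
  have h := coordRingToFun_injective X
  exact isReduced_of_injective (coordRingToFun X) h

theorem pderiv_rename_eq_zero {κ : Type*} (σ : κ → Fin N) (p : MvPolynomial κ ℝ) {m : Fin N}
    (hm : m ∉ Set.range σ) : MvPolynomial.pderiv m (MvPolynomial.rename σ p) = 0 := by
  classical
  apply MvPolynomial.pderiv_eq_zero_of_notMem_vars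
  intro h
  have := MvPolynomial.vars_rename σ p h
  obtain ⟨i, -, rfl⟩ := Finset.mem_image.mp this
  exact hm ⟨i, rfl⟩

/-- A coordinate function algebraic over a family of coordinate functions satisfies a separable
relation. -/
theorem exists_separable_relation {κ : Type*} {B : Type*} [CommRing B] [IsDomain B] [Algebra ℝ B]
    (σ : κ → Fin N) (ξ : Fin N → B) (hξ : AlgebraicIndependent ℝ fun i => ξ (σ i)) (l : Fin N)
    (hl : IsAlgebraic (Algebra.adjoin ℝ (Set.range fun i => ξ (σ i))) (ξ l)) :
    ∃ G D : MvPolynomial (Fin N) ℝ, MvPolynomial.aeval ξ G = 0 ∧ MvPolynomial.aeval ξ D ≠ 0 ∧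
      ∀ m ∉ Set.range σ, MvPolynomial.pderiv m G =
        D * MvPolynomial.pderiv m (MvPolynomial.X l) := by
  classical
  let φ : MvPolynomial κ ℝ →+* B := (MvPolynomial.aeval fun i => ξ (σ i) : _ →ₐ[ℝ] B).toRingHom
  have hφ : Function.Injective φ := algebraicIndependent_iff_injective_aeval.mp hξ
  have hex : ∃ n, ∃ p : Polynomial (MvPolynomial κ ℝ), p.natDegree = n ∧ p ≠ 0 ∧
      p.eval₂ φ (ξ l) = 0 := by
    obtain ⟨q, hq0, hq⟩ := hl
    let e := hξ.aevalEquiv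
    refine ⟨_, q.map (e.symm : _ →+* MvPolynomial κ ℝ), rfl, ?_, ?_⟩
    · rw [Ne, Polynomial.map_eq_zero_iff]
      · exact hq0
      · exact e.symm.injective
    · rw [Polynomial.eval₂_map]
      rw [Polynomial.aeval_def] at hq
      have hcomp : φ.comp (e.symm : Algebra.adjoin ℝ (Set.range fun i => ξ (σ i)) →+*
          MvPolynomial κ ℝ) = algebraMap _ B := by
        refine RingHom.ext fun a => ?_
        obtain ⟨c, rfl⟩ := e.surjective a
        simp only [RingHom.comp_apply, RingHom.coe_coe, AlgEquiv.symm_apply_apply]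
        exact (hξ.algebraMap_aevalEquiv c).symm
      rw [hcomp, hq]
  obtain ⟨p, hpn, hp0, hp⟩ := Nat.find_spec hex
  have hmin : ∀ p' : Polynomial (MvPolynomial κ ℝ), p' ≠ 0 → p'.eval₂ φ (ξ l) = 0 →
      p.natDegree ≤ p'.natDegree := by
    intro p' h1 h2
    rw [hpn]
    exact Nat.find_min' hex ⟨p', rfl, h1, h2⟩
  have hdeg : p.natDegree ≠ 0 := by
    intro h0
    rw [Polynomial.eq_C_of_natDegree_eq_zero h0, Polynomial.eval₂_C,
      map_eq_zero_iff φ hφ] at hp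
    rw [Polynomial.eq_C_of_natDegree_eq_zero h0, hp, Polynomial.C_0] at hp0
    exact hp0 rfl
  -- In characteristic zero the derivative is nonzero and of smaller degree, so minimality of `p`
  -- prevents it from vanishing at `ξ l`.
  have hder : p.derivative.eval₂ φ (ξ l) ≠ 0 := by
    intro h0
    have hlt := Polynomial.natDegree_derivative_lt hdeg
    by_cases hd0 : p.derivative = 0
    · exact hdeg (Polynomial.derivative_eq_zero.mp hd0)
    · exact absurd (hmin _ hd0 h0) (by omega)
  let τ : MvPolynomial κ ℝ →+* MvPolynomial (Fin N) ℝ := (MvPolynomial.rename σ).toRingHom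
  have hτ : ∀ q : Polynomial (MvPolynomial κ ℝ),
      MvPolynomial.aeval ξ (q.eval₂ τ (MvPolynomial.X l)) = q.eval₂ φ (ξ l) := by
    intro q
    have h1 := Polynomial.hom_eval₂ q τ (MvPolynomial.aeval ξ : _ →ₐ[ℝ] B).toRingHom
      (MvPolynomial.X l)
    refine h1.trans ?_
    congr 1
    · refine RingHom.ext fun a => ?_
      exact MvPolynomial.aeval_rename σ ξ a
    · exact MvPolynomial.aeval_X ξ l
  refine ⟨p.eval₂ τ (MvPolynomial.X l), p.derivative.eval₂ τ (MvPolynomial.X l),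
    by rw [hτ, hp], by rw [hτ]; exact hder, ?_⟩
  intro m hm
  clear hpn hp0 hp hmin hdeg hder
  induction p using Polynomial.induction_on' with
  | add p q hp hq =>
    rw [Polynomial.eval₂_add, map_add, hp, hq, Polynomial.derivative_add, Polynomial.eval₂_add]
    ring
  | monomial n a =>
    rw [Polynomial.eval₂_monomial, Polynomial.derivative_monomial, Polynomial.eval₂_monomial,
      MvPolynomial.pderiv_mul, MvPolynomial.pderiv_pow]
    have : MvPolynomial.pderiv m (τ a) = 0 := pderiv_rename_eq_zero σ a hm
    rw [this, map_mul, map_natCast]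
    ring

theorem height_map_le_height_of_ker_le {R S : Type*} [CommRing R] [CommRing S] (f : R →+* S)
    (hf : Function.Surjective f) (m : Ideal R) [hm : m.IsPrime] (h : RingHom.ker f ≤ m) :
    (m.map f).height ≤ m.height := by
  have hp : (m.map f).IsPrime := Ideal.map_isPrime_of_surjective hf h
  have hc : (m.map f).comap f = m := by
    rw [Ideal.comap_map_of_surjective f hf]
    exact sup_eq_left.mpr h
  have h1 := Order.height_le_height_apply_of_strictMono (PrimeSpectrum.comap f)
    (RingHom.strictMono_comap_of_surjective hf) ⟨m.map f, hp⟩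
  have h2 : PrimeSpectrum.comap f ⟨m.map f, hp⟩ = ⟨m, hm⟩ := PrimeSpectrum.ext hc
  rw [h2, ← PrimeSpectrum.height_eq_orderHeight, ← PrimeSpectrum.height_eq_orderHeight] at h1
  exact h1

/-- A `d`-dimensional set has a point at which its local ring has dimension at least `d` and its
tangent space has dimension at most `d`. -/
theorem exists_regular_point {d : ℕ} {X : Set (Fin N → ℝ)} (hd : dim X = (d : WithBot ℕ∞)) :
    ∃ x : X, (d : ℕ∞) ≤ (idealAt X x).height ∧ ∀ χ : AdaptedChart X x.1, χ.dim ≤ d := by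
  classical
  let R := CoordRing X
  have hnt : Nontrivial R := by
    by_contra h
    rw [not_nontrivial_iff_subsingleton] at h
    have := ringKrullDim_eq_bot_of_subsingleton (R := R)
    rw [show ringKrullDim R = d from hd] at this
    exact absurd this (by simp)
  have hred : IsReduced R := isReduced_coordRing X
  obtain ⟨s, g, hg, hgi⟩ := exists_integral_inj_algHom_of_fg ℝ R
  have hsd : s = d := by
    let _ := g.toRingHom.toAlgebra
    have : Algebra.IsIntegral (MvPolynomial (Fin s) ℝ) R := ⟨hgi⟩
    have : FaithfulSMul (MvPolynomial (Fin s) ℝ) R :=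
      (faithfulSMul_iff_algebraMap_injective _ _).mpr hg
    have h1 := ringKrullDim_eq_of_isIntegral (MvPolynomial (Fin s) ℝ) R
    rw [show ringKrullDim R = d from hd] at h1
    simp only [MvPolynomial.ringKrullDim_of_isNoetherianRing, ringKrullDim_eq_zero_of_field,
      Nat.card_eq_fintype_card, Fintype.card_fin, zero_add] at h1
    exact_mod_cast h1.symm
  subst hsd
  -- This selects an irreducible component of full dimension: the Noether normalization of `R`
  -- remains one for `R ⧸ P`.
  obtain ⟨P, hP, hinj⟩ := exists_isPrime_injective_comp g.toRingHom hg
  have hPp : P.IsPrime := hP.1.1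
  let B := R ⧸ P
  let g' : MvPolynomial (Fin s) ℝ →ₐ[ℝ] B := (Ideal.Quotient.mkₐ ℝ P).comp g
  have hg' : Function.Injective g' := hinj
  have hgi' : g'.toRingHom.IsIntegral :=
    RingHom.IsIntegral.trans g.toRingHom (Ideal.Quotient.mk P) hgi
      (RingHom.isIntegral_of_surjective _ Ideal.Quotient.mk_surjective)
  let q : MvPolynomial (Fin N) ℝ →ₐ[ℝ] B :=
    (Ideal.Quotient.mkₐ ℝ P).comp (Ideal.Quotient.mkₐ ℝ (MvPolynomial.vanishingIdeal ℝ X))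
  have hq : Function.Surjective q :=
    Ideal.Quotient.mk_surjective.comp Ideal.Quotient.mk_surjective
  let ξ : Fin N → B := fun l => q (MvPolynomial.X l)
  have hqξ : ∀ f, MvPolynomial.aeval ξ f = q f := by
    intro f
    have : MvPolynomial.aeval ξ = q := by ext; simp [ξ]
    rw [this]
  have hgen : Algebra.adjoin ℝ (Set.range ξ) = ⊤ := by
    rw [Algebra.adjoin_range_eq_range_aeval, AlgHom.range_eq_top]
    intro b
    obtain ⟨f, rfl⟩ := hq b
    exact ⟨f, hqξ f⟩
  have halg : Algebra.IsAlgebraic (Algebra.adjoin ℝ (Set.range ξ)) B := by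
    refine ⟨fun b => ?_⟩
    have hb : b ∈ Algebra.adjoin ℝ (Set.range ξ) := by rw [hgen]; trivial
    exact isAlgebraic_algebraMap (⟨b, hb⟩ : Algebra.adjoin ℝ (Set.range ξ))
  have hB : IsDomain B := Ideal.Quotient.isDomain P
  have hfs : FaithfulSMul ℝ B :=
    (faithfulSMul_iff_algebraMap_injective ℝ B).mpr (algebraMap ℝ B).injective
  obtain ⟨t, htξ, ht⟩ := exists_isTranscendenceBasis_subset (R := ℝ) (Set.range ξ)
  have hσ : ∀ a : t, ∃ i, ξ i = (a : B) := fun a => htξ a.2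
  choose σ hσ using hσ
  have hfun : (fun a : t => ξ (σ a)) = ((↑) : t → B) := funext hσ
  have hfin : Finite t := Finite.of_injective σ fun a b hab => by
    apply Subtype.ext
    rw [← hσ, ← hσ, hab]
  have hft := Fintype.ofFinite t
  have hcard : Fintype.card t = s := by
    have := ht.lift_cardinalMk_eq (isTranscendenceBasis_of_isIntegral g' hg' hgi')
    simpa using this
  have hrel : ∀ l, ∃ G D : MvPolynomial (Fin N) ℝ, q G = 0 ∧ q D ≠ 0 ∧
      ∀ m ∉ Set.range σ, MvPolynomial.pderiv m G =
        D * MvPolynomial.pderiv m (MvPolynomial.X l) := by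
    intro l
    obtain ⟨G, D, h1, h2, h3⟩ := exists_separable_relation σ ξ (by rw [hfun]; exact ht.1) l (by
      have := ht.isAlgebraic
      rw [← hfun] at this
      exact this.isAlgebraic (ξ l))
    rw [hqξ] at h1 h2
    exact ⟨G, D, h1, h2, h3⟩
  choose G D hG hD hGD using hrel
  obtain ⟨e', he'P, he'⟩ := exists_notMem_mul_eq_zero hP
  obtain ⟨e, rfl⟩ := Ideal.Quotient.mk_surjective e'
  have hqe : q e ≠ 0 := fun h => he'P (Ideal.Quotient.eq_zero_iff_mem.mp h)
  have hprod : q (e * ∏ l, D l) ≠ 0 := by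
    rw [map_mul, map_prod]
    exact mul_ne_zero hqe (Finset.prod_ne_zero_iff.mpr fun l _ => hD l)
  -- Because `I(X)` is the full ideal of the real points of `X`, a polynomial outside it is nonzero
  -- at some real point. There no other component interferes (`e`) and every relation `G l` can be
  -- solved to first order (`D l`).
  have hmk : e * ∏ l, D l ∉ MvPolynomial.vanishingIdeal ℝ X := by
    intro h
    apply hprod
    change Ideal.Quotient.mk P (Ideal.Quotient.mk _ _) = 0
    rw [Ideal.Quotient.eq_zero_iff_mem.mpr h, map_zero]
  rw [MvPolynomial.mem_vanishingIdeal_iff] at hmk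
  push Not at hmk
  obtain ⟨x, hx, hx0⟩ := hmk
  rw [MvPolynomial.aeval_eq_eval, map_mul, map_prod] at hx0
  have hex : MvPolynomial.eval x e ≠ 0 := left_ne_zero_of_mul hx0
  have hDx : ∀ l, MvPolynomial.eval x (D l) ≠ 0 := fun l =>
    Finset.prod_ne_zero_iff.mp (right_ne_zero_of_mul hx0) l (Finset.mem_univ l)
  have heI : ∀ f, q f = 0 → e * f ∈ MvPolynomial.vanishingIdeal ℝ X := by
    intro f hf
    rw [← Ideal.Quotient.eq_zero_iff_mem, map_mul]
    exact he' _ (Ideal.Quotient.eq_zero_iff_mem.mp hf)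
  have hf0 : ∀ f, q f = 0 → MvPolynomial.eval x f = 0 := by
    intro f hf
    have : MvPolynomial.eval x (e * f) = 0 := vanishingIdeal_le_pointIdeal hx (heI f hf)
    rw [map_mul] at this
    exact (mul_eq_zero.mp this).resolve_left hex
  refine ⟨⟨x, hx⟩, ?_, fun χ => ?_⟩
  · have hPle : P ≤ idealAt X ⟨x, hx⟩ := by
      intro a ha
      obtain ⟨f, rfl⟩ := Ideal.Quotient.mk_surjective a
      rw [← map_pointIdeal]
      exact Ideal.mem_map_of_mem _ (hf0 f (Ideal.Quotient.eq_zero_iff_mem.mpr ha))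
    have hmax : (idealAt X ⟨x, hx⟩).IsMaximal := by
      apply RingHom.ker_isMaximal_of_surjective
      intro r
      exact ⟨Ideal.Quotient.mk _ (MvPolynomial.C r), MvPolynomial.eval_C r⟩
    have hker : RingHom.ker (Ideal.Quotient.mk P) ≤ idealAt X ⟨x, hx⟩ := by
      rw [Ideal.mk_ker]; exact hPle
    have hmax' : ((idealAt X ⟨x, hx⟩).map (Ideal.Quotient.mk P)).IsMaximal :=
      hmax.map_of_surjective_of_ker_le Ideal.Quotient.mk_surjective hker
    exact (height_eq_of_isMaximal_of_isIntegral g' hg' hgi'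
      ((idealAt X ⟨x, hx⟩).map (Ideal.Quotient.mk P))).trans
        (height_map_le_height_of_ker_le _ Ideal.Quotient.mk_surjective _ hker)
  · rw [← hcard]
    refine χ.dim_le_card (fun a : t => Pi.single (σ a) 1) fun l => ?_
    set W := conormalSpace X x ⊔
      Submodule.span ℝ (Set.range fun a : t => (Pi.single (σ a) 1 : Fin N → ℝ)) with hW
    have hσW : ∀ m ∈ Set.range σ, (Pi.single m 1 : Fin N → ℝ) ∈ W := by
      rintro _ ⟨a, rfl⟩
      exact Submodule.mem_sup_right (Submodule.subset_span ⟨a, rfl⟩)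
    -- `G l` vanishes only on the chosen component, but `e * G l` is in `I(X)`; as `G l` vanishes at
    -- `x`, the two gradients differ by the nonzero factor `e(x)`.
    have h1 : gradient x (G l) ∈ W := by
      have h2 : gradient x (e * G l) ∈ W :=
        Submodule.mem_sup_left ⟨_, heI _ (hG l), rfl⟩
      rw [gradient_mul, hf0 _ (hG l), zero_smul, add_zero] at h2
      have := W.smul_mem (MvPolynomial.eval x e)⁻¹ h2
      rwa [smul_smul, inv_mul_cancel₀ hex, one_smul] at this
    -- Outside the transcendence basis, the partial derivatives of `G l` are those of `D l * X l`
    -- with `D l` treated as constant, so the difference involves only basis directions.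
    have h3 : gradient x (G l) - MvPolynomial.eval x (D l) • (Pi.single l 1 : Fin N → ℝ) ∈ W := by
      set w := gradient x (G l) - MvPolynomial.eval x (D l) • (Pi.single l 1 : Fin N → ℝ)
      have hw : w = ∑ m, w m • (Pi.single m 1 : Fin N → ℝ) := by
        funext i
        simp [Finset.sum_apply, Pi.single_apply]
      rw [hw]
      refine W.sum_mem fun m _ => ?_
      by_cases hm : m ∈ Set.range σ
      · exact W.smul_mem _ (hσW m hm)
      · have : w m = 0 := by
          simp only [w, Pi.sub_apply, Pi.smul_apply, gradient_apply, hGD l m hm, map_mul,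
            MvPolynomial.pderiv_X, smul_eq_mul]
          by_cases hml : m = l
          · subst hml; simp
          · simp [hml, Ne.symm hml]
        rw [this, zero_smul]
        exact W.zero_mem
    have h4 := W.sub_mem h1 h3
    rw [sub_sub_cancel] at h4
    have := W.smul_mem (MvPolynomial.eval x (D l))⁻¹ h4
    rwa [smul_smul, inv_mul_cancel₀ (hDx l), one_smul] at this

end GenericPoint

/-! ### Lower bounds and the non-singular case. -/

section LowerBound

/-- If the image of `A` under some polynomial map to `ℝ^ι` contains an open box, then the
dimension of `A` is at least the cardinality of `ι`. -/
theorem card_le_dim_of_box_subset_image {σ ι : Type*} [Finite σ] [Fintype ι] {A : Set (σ → ℝ)}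
    (F : ι → MvPolynomial σ ℝ) {ε : ℝ} (hε : 0 < ε)
    (h : ∀ z : ι → ℝ, (∀ p, z p ∈ Set.Ioo (-ε) ε) →
      ∃ a ∈ A, ∀ p, MvPolynomial.eval a (F p) = z p) :
    (Fintype.card ι : WithBot ℕ∞) ≤ dim A := by
  have hind : AlgebraicIndependent ℝ
      fun p => (Ideal.Quotient.mk (MvPolynomial.vanishingIdeal ℝ A) (F p) : CoordRing A) := by
    rw [algebraicIndependent_iff]
    intro Q hQ
    refine MvPolynomial.funext_set (fun _ => Set.Ioo (-ε) ε)
      (fun _ => Set.Ioo_infinite (by linarith)) fun z hz => ?_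
    obtain ⟨a, ha, haz⟩ := h z fun p => hz p trivial
    have h1 : (MvPolynomial.aeval fun p =>
        (Ideal.Quotient.mk (MvPolynomial.vanishingIdeal ℝ A) (F p) : CoordRing A)) Q =
        Ideal.Quotient.mk _ (MvPolynomial.aeval F Q) :=
      (MvPolynomial.comp_aeval_apply _ (Ideal.Quotient.mkₐ ℝ (MvPolynomial.vanishingIdeal ℝ A))
        Q).symm
    rw [h1, Ideal.Quotient.eq_zero_iff_mem] at hQ
    have h2 := hQ a ha
    rw [MvPolynomial.comp_aeval_apply] at h2
    have h3 : (fun p => MvPolynomial.aeval a (F p)) = z := funext fun p => by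
      rw [← haz p, MvPolynomial.aeval_eq_eval]
    rw [h3, MvPolynomial.aeval_eq_eval] at h2
    rw [h2, map_zero]
  exact natCard_le_ringKrullDim_of_algebraicIndependent hind

variable {N : ℕ}

/-- The Taylor coefficients of the tangent coordinates of an arc on `X` can be prescribed freely in
a box. Since these coordinates are affine-linear, their Taylor coefficients are polynomial functions
of the jet. -/
theorem AdaptedChart.le_dim_liftableJets {X : Set (Fin N → ℝ)} {x : Fin N → ℝ}
    (χ : AdaptedChart X x) (hx : x ∈ X) (hdim : (χ.dim : ℕ∞) ≤ (idealAt X ⟨x, hx⟩).height)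
    (n : ℕ) : (((n + 1) * χ.dim : ℕ) : WithBot ℕ∞) ≤ RealAlg.dim (liftableJets X n) := by
  obtain ⟨Ψ, U, hU, h0U, -, hΨ, hP, hX⟩ := χ.exists_parametrization hx hdim
  obtain ⟨ε, hε, hball⟩ := Metric.isOpen_iff.mp hU 0 h0U
  have hcard : Fintype.card (Fin χ.dim × Fin (n + 1)) = (n + 1) * χ.dim := by
    simp [mul_comm]
  rw [← hcard]
  -- The base point `x` enters the affine-linear coordinates only at order `0`, whence the case
  -- distinction.
  refine card_le_dim_of_box_subset_image
    (fun p : Fin χ.dim × Fin (n + 1) => ∑ l, MvPolynomial.C (χ.basis (Sum.inr p.1) l) *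
      (MvPolynomial.X (l, p.2) - MvPolynomial.C (if p.2 = 0 then x l else 0))) hε fun z hz => ?_
  let ζ : ℝ → Fin χ.dim → ℝ := fun t j => (Jet.poly (n := n) z j).eval t
  have h0 : (Sum.elim (fun _ => 0) (ζ 0) : Fin χ.codim ⊕ Fin χ.dim → ℝ) ∈ U := by
    apply hball
    rw [mem_ball_zero_iff, pi_norm_lt_iff hε]
    rintro (i | j)
    · simpa using hε
    · have : ζ 0 j = z (j, 0) := by
        change (Jet.poly (n := n) z j).eval 0 = _
        rw [← Polynomial.coeff_zero_eq_eval_zero, coeff_poly, dif_pos (Nat.succ_pos n)]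
        rfl
      rw [Sum.elim_inr, this, Real.norm_eq_abs, abs_lt]
      exact hz (j, 0)
  obtain ⟨harc, hev⟩ := χ.isArcOn_parametrization hU hΨ hX (ζ := ζ)
    (fun j => AnalyticOnNhd.eval_polynomial (Jet.poly (n := n) z j) 0 trivial) h0
  set γ : ℝ → Fin N → ℝ := fun t => Ψ (Sum.elim (fun _ => 0) (ζ t))
  refine ⟨arcJet n γ, ⟨γ, harc, rfl⟩, fun ⟨j, k⟩ => ?_⟩
  have h1 : taylorSeries (fun t => MvPolynomial.eval (γ t) (χ.P (Sum.inr j))) =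
      (Jet.poly (n := n) z j : PowerSeries ℝ) := by
    rw [← taylorSeries_polynomial]
    apply taylorSeries_congr
    filter_upwards [hev] with t ht
    exact hP _ ht (Sum.inr j)
  rw [taylorSeries_eval (analyticAt_pi_apply harc.1), χ.P_inr] at h1
  have h2 := congrArg (PowerSeries.coeff (k : ℕ)) h1
  rw [Polynomial.coeff_coe, coeff_poly, dif_pos k.2] at h2
  have h3 : ∀ r : ℝ, MvPolynomial.aeval (fun i => taylorSeries fun t => γ t i)
      (MvPolynomial.C r) = PowerSeries.C r := fun r => MvPolynomial.aeval_C _ r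
  simp only [map_sum, map_mul, map_sub, MvPolynomial.aeval_X, h3, PowerSeries.coeff_C_mul,
    PowerSeries.coeff_C, Fin.val_eq_zero_iff] at h2
  simp only [map_sum, map_mul, map_sub, MvPolynomial.eval_X, MvPolynomial.eval_C, arcJet_apply]
  exact h2

theorem le_dim_liftableJets {d : ℕ} {X : Set (Fin N → ℝ)} (hd : dim X = (d : WithBot ℕ∞))
    (n : ℕ) : (((n + 1) * d : ℕ) : WithBot ℕ∞) ≤ dim (liftableJets X n) := by
  obtain ⟨⟨x, hx⟩, hle, hχ⟩ := exists_regular_point hd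
  obtain ⟨χ⟩ := exists_adaptedChart hx
  have hχd : χ.dim = d :=
    le_antisymm (hχ χ) (by exact_mod_cast hle.trans (χ.height_le hx))
  have := χ.le_dim_liftableJets hx (by rw [hχd]; exact hle) n
  rwa [hχd] at this

theorem dim_liftableJets {d : ℕ} {X : Set (Fin N → ℝ)} (hd : dim X = (d : WithBot ℕ∞))
    (n : ℕ) : dim (liftableJets X n) = (((n + 1) * d : ℕ) : WithBot ℕ∞) :=
  le_antisymm (dim_liftableJets_le hd n) (le_dim_liftableJets hd n)

theorem origin_mem_of_mem_jets {X : Set (Fin N → ℝ)} (hX : IsAlgebraicSet X) {n : ℕ}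
    {ξ : Jet N n} (hξ : ξ ∈ jets X n) : ξ.origin ∈ X := by
  obtain ⟨S, rfl⟩ := hX
  intro f hf
  obtain ⟨q, hq⟩ := hξ f fun y hy => by
    rw [MvPolynomial.aeval_eq_eval]
    exact hy f hf
  rw [← eval_zero_aeval_poly, hq]
  simp

theorem IsNonsingular.jets_eq_liftableJets {X : Set (Fin N → ℝ)} (hX : IsAlgebraicSet X)
    (hns : IsNonsingular X) (n : ℕ) : jets X n = liftableJets X n := by
  refine Set.Subset.antisymm (fun ξ hξ => ?_) (liftableJets_subset_jets X n)
  have hx := origin_mem_of_mem_jets hX hξ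
  obtain ⟨χ⟩ := exists_adaptedChart hx
  exact χ.mem_liftableJets hξ hx
    (AdaptedChart.dim_le_height_of_isRegularLocalRing ⟨ξ.origin, hx⟩ χ (hns _))

end LowerBound

end RealAlg
theorem proposition2p22 (N d : ℕ) (X : Set (Fin N → ℝ)) (hX : RealAlg.IsAlgebraicSet X)
    (hd : RealAlg.dim X = (d : WithBot ℕ∞)) :
    (∀ n : ℕ, RealAlg.dim (RealAlg.liftableJets X n) = (((n + 1) * d : ℕ) : WithBot ℕ∞)) ∧
    (∀ n : ℕ, (((n + 1) * d : ℕ) : WithBot ℕ∞) ≤ RealAlg.dim (RealAlg.jets X n)) ∧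
    (∀ (n m : ℕ) (h : n ≤ m), ∀ γ ∈ RealAlg.liftableJets X n,
      RealAlg.dim {ξ | ξ ∈ RealAlg.liftableJets X m ∧ RealAlg.trunc h ξ = γ} ≤
        (((m - n) * d : ℕ) : WithBot ℕ∞)) ∧
    (∀ n : ℕ, ∀ γ ∈ RealAlg.jets X n,
      {ξ | ξ ∈ RealAlg.jets X (n + 1) ∧ RealAlg.trunc (Nat.le_succ n) ξ = γ} = ∅ ∨
      RealAlg.AffinelyIsomorphic
        {ξ | ξ ∈ RealAlg.jets X (n + 1) ∧ RealAlg.trunc (Nat.le_succ n) ξ = γ}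
        (RealAlg.tangentSpace X γ.origin : Set (Fin N → ℝ))) ∧
    (RealAlg.IsNonsingular X → ∀ n : ℕ,
      RealAlg.jets X n = RealAlg.liftableJets X n ∧
      RealAlg.dim (RealAlg.jets X n) = (((n + 1) * d : ℕ) : WithBot ℕ∞)) :=
  ⟨RealAlg.dim_liftableJets hd,
    fun n => (RealAlg.le_dim_liftableJets hd n).trans
      (RealAlg.dim_mono (RealAlg.liftableJets_subset_jets X n)),
    fun _ _ h γ _ => RealAlg.dim_fibre_liftableJets_le hd h γ,
    fun n γ _ => RealAlg.jets_fibre_affinelyIsomorphic X n γ,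
    fun hns n => ⟨hns.jets_eq_liftableJets hX n,
      (congrArg RealAlg.dim (hns.jets_eq_liftableJets hX n)).trans
        (RealAlg.dim_liftableJets hd n)⟩⟩
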